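/- Let $N\ge 1$ be an integer, $S_0>0$, $\Delta t>0$, $\mu,r\in\mathbb R$ and $0<\sigma<\frac1{2\Delta t}$. On $\mathbb R^N$ with coordinates $y_1,\dots,y_N$, let $\mathcal F_n=\sigma(y_1,\dots,y_n)$, let $P=P_1^{\otimes N}$, where $P_1=N(0,\Delta t)$ is the centred Gaussian law of variance $\Delta t$, and put $\zeta_n=y_1+\dots+y_n$. The discounted price of the risky asset is $$S_n=S_0e^{(\mu-\frac{\sigma^2}{2}-r)n\Delta t+\sigma\zeta_n}=(1+\rho(y_n))S_{n-1},\qquad \rho(y)=e^{(\mu-\frac{\sigma^2}{2}-r)\Delta t+\sigma y}-1 .$$ Let $\Omega^-=\{\rho\le 0\}$, $\Omega^+=\{\rho>0\}$, $\rho^\pm=\max(\pm\rho,0)$, and let $\nu=P_1|_{\Omega^-}\times P_1|_{\Omega^+}$. Let $M_1^0$ be the set of all measures on $\mathbb R$ of the form $$Q(A)=\int\Big[\chi_A(y_1)\frac{\rho^+(y_2)}{\rho^-(y_1)+\rho^+(y_2)}+\chi_A(y_2)\frac{\rho^-(y_1)}{\rho^-(y_1)+\rho^+(y_2)}\Big]\alpha(y_1,y_2)\,d\nu(y_1,y_2),$$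 where $\alpha\ge0$ is measurable, $\alpha>0$ $\nu$-almost everywhere, $\int\alpha\,d\nu=1$ and $\int\alpha\,\frac{\rho^-(y_1)\rho^+(y_2)}{\rho^-(y_1)+\rho^+(y_2)}\,d\nu<\infty$. Let $M^N=\{Q_1\times\dots\times Q_N:\ Q_i\in M_1^0\}$ and let $M_0^N$ be the convex hull of $M^N$. Let $f$ be a real Borel function such that for every $s>0$ and every $c<f(s)$, the set $\{f>c\}$ meets every neighbourhood of $s$ in a set of positive Lebesgue measure (this holds, for instance, if $f$ is lower semicontinuous, or if at every point it is continuous from the left or from the right). Suppose that $f(S_N)$ is integrable with respect to every $Q\in M_0^N$ and that $\sup_{Q\in M_0^N}E^Qf(S_N)<\infty$. The fair price of the super-hedge of the payment $f(S_N)$ is the infimum of all $x\in\mathbb R$ for which there are $\mathcal F_{n-1}$-measurable $H_n$, $n=1,\dots,N$, with $$x+\sum_{n=1}^N H_n(S_n-S_{n-1})\ \ge\ f(S_N)\qquad P\text{-almost surely.}$$ Then this fair price equals $\sup_{Q\in M_0^N}E^Qf(S_N)$, and $$\sup_{Q\in M_0^N}E^Qf(S_N)=\sup_{\substack{y_s^1\le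 -d,\ y_s^2>-d\\ s=1,\dots,N}}\ \sum_{i_1,\dots,i_N=1}^{2} f\Big(S_0\prod_{s=1}^N\big(1+\rho(y_s^{i_s})\big)\Big)\prod_{s=1}^N\frac{\big|e^{\sigma(d+y_s^{i_s+1})}-1\big|}{\big|e^{\sigma(d+y_s^{i_s+1})}-e^{\sigma(d+y_s^{i_s})}\big|},$$ where $d=\frac{(\mu-\frac{\sigma^2}{2}-r)\Delta t}{\sigma}$ and $y_s^3=y_s^1$. -/

import Mathlib

open MeasureTheory ProbabilityTheory
open scoped NNReal ENNReal Topology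

namespace DriftedGBM

noncomputable section

/-- The space of paths `y = (y_1, …, y_N)` of the `N` increments of the discrete Brownian motion. -/
abbrev Path (N : ℕ) : Type := Fin N → ℝ

/-- The law of one increment: centred Gaussian with variance `Δt`. -/
def stepLaw (Δt : ℝ) : Measure ℝ := gaussianReal 0 Δt.toNNReal

/-- The reference measure: the product law of the `N` independent increments. -/
def pathLaw (Δt : ℝ) (N : ℕ) : Measure (Path N) := Measure.pi fun _ => stepLaw Δt

/-- The discrete Brownian motion `ζ_n = y_1 + ⋯ + y_n`. -/
def zeta {N : ℕ} (n : ℕ) (y : Path N) : ℝ :=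
  ∑ i ∈ Finset.univ.filter (fun i : Fin N => i.val < n), y i

/-- The discounted price `S_n = S_0 exp ((μ - σ²/2 - r) n Δt + σ ζ_n)`. -/
def price {N : ℕ} (S₀ μ σ r Δt : ℝ) (n : ℕ) (y : Path N) : ℝ :=
  S₀ * Real.exp ((μ - σ ^ 2 / 2 - r) * n * Δt + σ * zeta n y)

/-- The one-step return `ρ(y) = exp ((μ - σ²/2 - r) Δt + σ y) - 1`, so `S_n = (1 + ρ(y_n)) S_{n-1}`. -/
def rho (μ σ r Δt : ℝ) (y : ℝ) : ℝ := Real.exp ((μ - σ ^ 2 / 2 - r) * Δt + σ * y) - 1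

/-! ### Martingale measures -/

section OneStep

variable (P : Measure ℝ) (ρ : ℝ → ℝ)

/-- `Ω⁻ = {ρ ≤ 0}`. -/
def lossSet : Set ℝ := {y | ρ y ≤ 0}

/-- `Ω⁺ = {ρ > 0}`. -/
def gainSet : Set ℝ := {y | 0 < ρ y}

/-- The product `P⁻ × P⁺` of the restrictions of `P` to `Ω⁻` and `Ω⁺`. -/
def pairLaw : Measure (ℝ × ℝ) := (P.restrict (lossSet ρ)).prod (P.restrict (gainSet ρ))

/-- `ρ⁺(y₂) / (ρ⁻(y₁) + ρ⁺(y₂))`, the mass that a pair `(y₁, y₂)` puts on `y₁`. -/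
def lossMass (p : ℝ × ℝ) : ℝ := max (ρ p.2) 0 / (max (-ρ p.1) 0 + max (ρ p.2) 0)

/-- `ρ⁻(y₁) / (ρ⁻(y₁) + ρ⁺(y₂))`, the mass that a pair `(y₁, y₂)` puts on `y₂`. -/
def gainMass (p : ℝ × ℝ) : ℝ := max (-ρ p.1) 0 / (max (-ρ p.1) 0 + max (ρ p.2) 0)

/-- The conditions on the mixing density `α`: positive almost everywhere on `Ω⁻ × Ω⁺`,
with `∫ α ρ⁻ρ⁺/(ρ⁻+ρ⁺) < ∞` and `∫ α = 1`. -/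
structure IsMixingDensity (α : ℝ × ℝ → ℝ≥0) : Prop where
  measurable : Measurable α
  pos : pairLaw P ρ {p | 0 < α p} = P (gainSet ρ) * P (lossSet ρ)
  finite : ∫⁻ p, α p * ENNReal.ofReal
    (max (-ρ p.1) 0 * max (ρ p.2) 0 / (max (-ρ p.1) 0 + max (ρ p.2) 0)) ∂(pairLaw P ρ) < ∞
  total : ∫⁻ p, α p ∂(pairLaw P ρ) = 1

/-- The set `M_1^0` of one-step measures: mixtures, with an admissible density `α`, of the
two-point measures carried by `(y₁, y₂) ∈ Ω⁻ × Ω⁺`. -/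
def oneStepMeasures : Set (Measure ℝ) :=
  {Q | ∃ α : ℝ × ℝ → ℝ≥0, IsMixingDensity P ρ α ∧ ∀ A : Set ℝ, MeasurableSet A →
    Q A = ∫⁻ p, A.indicator 1 p.1 * α p * ENNReal.ofReal (lossMass ρ p) ∂(pairLaw P ρ)
        + ∫⁻ p, A.indicator 1 p.2 * α p * ENNReal.ofReal (gainMass ρ p) ∂(pairLaw P ρ)}

end OneStep

/-- The set `M^N` of product measures `Q_1 × ⋯ × Q_N` with all `Q_i ∈ M_1^0`. -/
def productMeasures (μ σ r Δt : ℝ) (N : ℕ) : Set (Measure (Path N)) :=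
  {Q | ∃ q : Fin N → Measure ℝ,
    (∀ i, q i ∈ oneStepMeasures (stepLaw Δt) (rho μ σ r Δt)) ∧ Q = Measure.pi q}

/-- The set `M_0^N`, the convex hull of `M^N`. -/
def martingaleMeasures (μ σ r Δt : ℝ) (N : ℕ) : Set (Measure (Path N)) :=
  convexHull ℝ≥0 (productMeasures μ σ r Δt N)

/-! ### Super-hedging -/

/-- The σ-algebra `ℱ_n` generated by the first `n` coordinates. -/
abbrev coordSigma (N n : ℕ) : MeasurableSpace (Path N) :=
  ⨆ (i : Fin N) (_ : i.val < n), MeasurableSpace.comap (fun y : Path N => y i) inferInstance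

/-- Initial capitals `x` from which some self-financing strategy, holding `H_n` units of the risky
asset over the `n`-th period with `H_n` measurable with respect to `ℱ_{n-1}`, has an almost surely
sufficient discounted terminal wealth: `x + ∑ H_n (S_n - S_{n-1}) ≥ f(S_N)`.
(The periods `1, …, N` are indexed by `i = n - 1 : Fin N`.) -/
def superHedgeCapitals (S₀ μ σ r Δt : ℝ) (N : ℕ) (f : ℝ → ℝ) : Set ℝ :=
  {x | ∃ H : Fin N → Path N → ℝ, (∀ i, Measurable[coordSigma N i.val] (H i)) ∧
    ∀ᵐ y ∂(pathLaw Δt N), f (price S₀ μ σ r Δt N y) ≤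
      x + ∑ i : Fin N,
        H i y * (price S₀ μ σ r Δt (i.val + 1) y - price S₀ μ σ r Δt i.val y)}

/-- The fair price of the super-hedge of the payment `f(S_N)`: the infimum of the super-hedging
initial capitals, as an extended real number. -/
def superHedgePrice (S₀ μ σ r Δt : ℝ) (N : ℕ) (f : ℝ → ℝ) : EReal :=
  ⨅ x ∈ superHedgeCapitals S₀ μ σ r Δt N f, (x : EReal)

/-! ### The two-point formula -/

/-- `d = (μ - σ²/2 - r) Δt / σ`. -/
def shift (μ σ r Δt : ℝ) : ℝ := (μ - σ ^ 2 / 2 - r) * Δt / σ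

/-- The families `(y_s^1, y_s^2)`, `s = 1, …, N`, with `y_s^1 ≤ -d < y_s^2`; the upper indices
`1, 2` are `0, 1 : Fin 2`. -/
def pairFamilies (μ σ r Δt : ℝ) (N : ℕ) : Set (Fin N → Fin 2 → ℝ) :=
  {y | ∀ s, y s 0 ≤ -shift μ σ r Δt ∧ -shift μ σ r Δt < y s 1}

/-- The sum over `(i_1, …, i_N) ∈ {1, 2}^N` of `f (S_0 ∏ (1 + ρ(y_s^{i_s})))` times
`∏ |e^{σ(d + y_s^{i_s+1})} - 1| / |e^{σ(d + y_s^{i_s+1})} - e^{σ(d + y_s^{i_s})}|`;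
addition in `Fin 2` implements the convention `y_s^3 = y_s^1`. -/
def twoPointValue (S₀ μ σ r Δt : ℝ) (N : ℕ) (f : ℝ → ℝ) (y : Fin N → Fin 2 → ℝ) : ℝ :=
  ∑ i : Fin N → Fin 2,
    f (S₀ * ∏ s, (1 + rho μ σ r Δt (y s (i s)))) *
      ∏ s, |Real.exp (σ * (shift μ σ r Δt + y s (i s + 1))) - 1| /
        |Real.exp (σ * (shift μ σ r Δt + y s (i s + 1)))
          - Real.exp (σ * (shift μ σ r Δt + y s (i s)))|

end

end DriftedGBM

/-!
A super-hedge integrates to at most its initial capital under every product of laws of mean zero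
return, so the supremum of the expectations is at most the fair price.

Conversely, the two-point values, and the expectations of `f(S_N)` alike, bound the chords of `f`
at `S₀` over pairs of prices `a < S₀ < b`. A real number bounding all these chords is the height at
`S₀` of a line above `f`. The slope of that line is a constant holding that super-hedges `f(S_N)`,
and the two-point values, being averages of `f(S_N)` with `S_N` of mean `S₀`, stay below the line.

That expectations bound chords is a concentration argument. By convexity the mixing densities may
be taken merely absolutely continuous. Concentrating the last `N - 1` factors near the point `-d` of
zero return turns them into a small translation `τ` of the first increment, and concentrating the
first factor on small boxes around `(x, y)` produces the two-point law on `{x, y}` in the limit if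
`x` and `y` are Lebesgue points of `u ↦ f(S₀(1 + ρ(u)))`. This gives the line above `f` almost
everywhere, hence everywhere by the regularity assumption on `f`.
-/

namespace DriftedGBM

/-! ### Prices and returns -/

section Price

variable {N : ℕ} {S₀ μ σ r Δt : ℝ}

theorem one_add_rho_pos (μ σ r Δt y : ℝ) : 0 < 1 + rho μ σ r Δt y := by
  simpa [rho] using Real.exp_pos _

theorem one_add_rho (hσ : σ ≠ 0) (y : ℝ) :
    1 + rho μ σ r Δt y = Real.exp (σ * (shift μ σ r Δt + y)) := by
  unfold rho shift
  rw [mul_add, mul_div_cancel₀ _ hσ, add_sub_cancel]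

theorem rho_nonpos_iff (hσ : 0 < σ) {y : ℝ} : rho μ σ r Δt y ≤ 0 ↔ y ≤ -shift μ σ r Δt := by
  rw [← add_le_iff_nonpos_right 1, one_add_rho hσ.ne', Real.exp_le_one_iff,
    mul_nonpos_iff_pos_imp_nonpos]
  grind

theorem rho_pos_iff (hσ : 0 < σ) {y : ℝ} : 0 < rho μ σ r Δt y ↔ -shift μ σ r Δt < y := by
  rw [← not_le, rho_nonpos_iff hσ, not_le]

theorem rho_neg_shift (hσ : σ ≠ 0) : rho μ σ r Δt (-shift μ σ r Δt) = 0 := by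
  simpa using one_add_rho (μ := μ) (r := r) (Δt := Δt) hσ (-shift μ σ r Δt)

theorem continuous_rho : Continuous (rho μ σ r Δt) := by
  unfold rho; fun_prop

theorem exists_one_add_rho_eq (hσ : σ ≠ 0) {t : ℝ} (ht : 0 < t) :
    ∃ y, 1 + rho μ σ r Δt y = t := by
  refine ⟨Real.log t / σ - shift μ σ r Δt, ?_⟩
  rw [one_add_rho hσ, add_sub_cancel, mul_div_cancel₀ _ hσ, Real.exp_log ht]

theorem price_pos (hS₀ : 0 < S₀) {n : ℕ} (y : Path N) : 0 < price S₀ μ σ r Δt n y :=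
  mul_pos hS₀ (Real.exp_pos _)

theorem price_zero (y : Path N) : price S₀ μ σ r Δt 0 y = S₀ := by
  simp [price, zeta]

theorem price_eq_prod (y : Path N) :
    price S₀ μ σ r Δt N y = S₀ * ∏ i, (1 + rho μ σ r Δt (y i)) := by
  have hζ : zeta N y = ∑ i, y i := by simp [zeta]
  simp only [price, rho, hζ, add_sub_cancel, ← Real.exp_sum, Finset.sum_add_distrib,
    ← Finset.mul_sum, Finset.sum_const, Finset.card_univ, Fintype.card_fin, nsmul_eq_mul]
  ring_nf

theorem dependsOn_price (i : Fin N) :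
    DependsOn (price S₀ μ σ r Δt i.val : Path N → ℝ) (Set.Iio i) := fun y z hyz => by
  have hζ : zeta i.val y = zeta i.val z :=
    Finset.sum_congr rfl fun j hj => hyz j (Finset.mem_filter.1 hj).2
  rw [price, price, hζ]

theorem zeta_succ (i : Fin N) (y : Path N) : zeta (i.val + 1) y = zeta i.val y + y i := by
  have hfilter : Finset.univ.filter (fun j : Fin N => j.val < i.val + 1)
      = insert i (Finset.univ.filter fun j : Fin N => j.val < i.val) := by
    ext j
    simp only [Finset.mem_filter, Finset.mem_univ, true_and, Finset.mem_insert, Fin.ext_iff]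
    omega
  unfold zeta
  rw [hfilter, Finset.sum_insert (by simp), add_comm]

theorem price_succ_sub (i : Fin N) (y : Path N) :
    price S₀ μ σ r Δt (i.val + 1) y - price S₀ μ σ r Δt i.val y
      = price S₀ μ σ r Δt i.val y * rho μ σ r Δt (y i) := by
  have hexp : (μ - σ ^ 2 / 2 - r) * ((i.val + 1 : ℕ) : ℝ) * Δt + σ * (zeta i.val y + y i)
      = ((μ - σ ^ 2 / 2 - r) * i.val * Δt + σ * zeta i.val y)
        + ((μ - σ ^ 2 / 2 - r) * Δt + σ * y i) := by
    push_cast; ring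
  unfold price rho
  rw [zeta_succ, hexp, Real.exp_add]
  ring

theorem sum_price_sub (y : Path N) :
    ∑ i : Fin N, (price S₀ μ σ r Δt (i.val + 1) y - price S₀ μ σ r Δt i.val y)
      = price S₀ μ σ r Δt N y - S₀ := by
  rw [Fin.sum_univ_eq_sum_range
    (fun n => price S₀ μ σ r Δt (n + 1) y - price S₀ μ σ r Δt n y),
    Finset.sum_range_sub (fun n => price S₀ μ σ r Δt n y), price_zero]

end Price

/-! ### Two-point laws of mean zero return -/

section Masses

variable {ρ : ℝ → ℝ} {p : ℝ × ℝ}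

theorem lossMass_nonneg : 0 ≤ lossMass ρ p := by
  unfold lossMass; positivity

theorem gainMass_nonneg : 0 ≤ gainMass ρ p := by
  unfold gainMass; positivity

theorem lossMass_le_one : lossMass ρ p ≤ 1 := by
  unfold lossMass
  exact div_le_one_of_le₀ (le_add_of_nonneg_left (le_max_right _ _)) (by positivity)

theorem gainMass_le_one : gainMass ρ p ≤ 1 := by
  unfold gainMass
  exact div_le_one_of_le₀ (le_add_of_nonneg_right (le_max_right _ _)) (by positivity)

theorem lossMass_eq (hloss : ρ p.1 ≤ 0) (hgain : 0 < ρ p.2) :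
    lossMass ρ p = ρ p.2 / (ρ p.2 - ρ p.1) := by
  rw [lossMass, max_eq_left hgain.le, max_eq_left (neg_nonneg.2 hloss), neg_add_eq_sub]

theorem gainMass_eq (hloss : ρ p.1 ≤ 0) (hgain : 0 < ρ p.2) :
    gainMass ρ p = -ρ p.1 / (ρ p.2 - ρ p.1) := by
  rw [gainMass, max_eq_left hgain.le, max_eq_left (neg_nonneg.2 hloss), neg_add_eq_sub]

theorem lossMass_add_gainMass (hgain : 0 < ρ p.2) : lossMass ρ p + gainMass ρ p = 1 := by
  have : max (-ρ p.1) 0 + max (ρ p.2) 0 ≠ 0 := by positivity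
  rw [lossMass, gainMass, ← add_div, add_comm, div_self this]

theorem lossMass_mul_add_gainMass_mul (hloss : ρ p.1 ≤ 0) (hgain : 0 < ρ p.2) :
    lossMass ρ p * ρ p.1 + gainMass ρ p * ρ p.2 = 0 := by
  rw [lossMass_eq hloss hgain, gainMass_eq hloss hgain]
  ring

theorem measurable_lossMass (hρ : Measurable ρ) : Measurable (lossMass ρ) := by
  unfold lossMass; fun_prop

theorem measurable_gainMass (hρ : Measurable ρ) : Measurable (gainMass ρ) := by
  unfold gainMass; fun_prop

theorem continuousAt_lossMass (hρ : Continuous ρ) (hgain : 0 < ρ p.2) :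
    ContinuousAt (lossMass ρ) p := by
  have : max (-ρ p.1) 0 + max (ρ p.2) 0 ≠ 0 := by positivity
  unfold lossMass
  fun_prop (disch := assumption)

theorem continuousAt_gainMass (hρ : Continuous ρ) (hgain : 0 < ρ p.2) :
    ContinuousAt (gainMass ρ) p := by
  have : max (-ρ p.1) 0 + max (ρ p.2) 0 ≠ 0 := by positivity
  unfold gainMass
  fun_prop (disch := assumption)

end Masses

/-! ### Chords and supporting lines -/

section Chord

variable {f : ℝ → ℝ} {s a b : ℝ}

/-- The value at `s` of the chord of `f` over `[a, b]`, i.e. the mean of `f` under the law on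
`{a, b}` with barycentre `s`. -/
noncomputable def chord (f : ℝ → ℝ) (s a b : ℝ) : ℝ :=
  (b - s) / (b - a) * f a + (s - a) / (b - a) * f b

theorem chord_eq_lossMass_gainMass {ρ : ℝ → ℝ} {p : ℝ × ℝ} (hs : s ≠ 0) (hloss : ρ p.1 ≤ 0)
    (hgain : 0 < ρ p.2) :
    chord f s (s * (1 + ρ p.1)) (s * (1 + ρ p.2))
      = lossMass ρ p * f (s * (1 + ρ p.1)) + gainMass ρ p * f (s * (1 + ρ p.2)) := by
  have hgap : s * (1 + ρ p.2) - s * (1 + ρ p.1) = s * (ρ p.2 - ρ p.1) := by ring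
  have hright : s * (1 + ρ p.2) - s = s * ρ p.2 := by ring
  have hleft : s - s * (1 + ρ p.1) = s * -ρ p.1 := by ring
  rw [lossMass_eq hloss hgain, gainMass_eq hloss hgain, chord, hgap, hright, hleft,
    mul_div_mul_left _ _ hs, mul_div_mul_left _ _ hs]

theorem slope_le_slope_of_chord_le {V : ℝ} (has : a < s) (hsb : s < b)
    (hV : chord f s a b ≤ V) : (f b - V) / (b - s) ≤ (V - f a) / (s - a) := by
  have hchord : chord f s a b = ((b - s) * f a + (s - a) * f b) / (b - a) := by
    unfold chord; ring
  rw [hchord, div_le_iff₀ (by linarith)] at hV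
  rw [div_le_div_iff₀ (by linarith) (by linarith)]
  linarith

theorem exists_supporting_line {A : Set ℝ} {V : ℝ} (hleft : (A ∩ Set.Iio s).Nonempty)
    (hright : (A ∩ Set.Ioi s).Nonempty)
    (hV : ∀ a ∈ A, ∀ b ∈ A, a < s → s < b → chord f s a b ≤ V) :
    ∃ h, ∀ t ∈ A, t ≠ s → f t ≤ V + h * (t - s) := by
  obtain ⟨h, hupper, hlower⟩ := exists_between_of_forall_le
    (s := (fun b => (f b - V) / (b - s)) '' (A ∩ Set.Ioi s))
    (t := (fun a => (V - f a) / (s - a)) '' (A ∩ Set.Iio s))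
    (hright.image _) (hleft.image _) (by
      rintro _ ⟨b, ⟨hbA, hsb⟩, rfl⟩ _ ⟨a, ⟨haA, has⟩, rfl⟩
      exact slope_le_slope_of_chord_le has hsb (hV a haA b hbA has hsb))
  refine ⟨h, fun t htA hts => ?_⟩
  rcases hts.lt_or_gt with hlt | hgt
  · have := hlower ⟨t, ⟨htA, hlt⟩, rfl⟩
    rw [le_div_iff₀ (sub_pos.2 hlt)] at this
    linarith
  · have := hupper ⟨t, ⟨htA, hgt⟩, rfl⟩
    rw [div_le_iff₀ (sub_pos.2 hgt)] at this
    linarith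

theorem exists_ae_supporting_line {A : Set ℝ} {V : ℝ} (hs : 0 < s)
    (hA : ∀ᵐ t, 0 < t → t ∈ A)
    (hV : ∀ a ∈ A, ∀ b ∈ A, a < s → s < b → chord f s a b ≤ V) :
    ∃ h, ∀ᵐ t, 0 < t → f t ≤ V + h * (t - s) := by
  have hleft : ∃ᵐ t, t ∈ Set.Ioo 0 s := frequently_ae_mem_iff.2 (by simpa using hs)
  have hright : ∃ᵐ t, t ∈ Set.Ioi s := frequently_ae_mem_iff.2 (by simp)
  obtain ⟨a, ha, haA⟩ := (hleft.and_eventually hA).exists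
  obtain ⟨b, hb, hbA⟩ := (hright.and_eventually hA).exists
  obtain ⟨h, hline⟩ := exists_supporting_line ⟨a, haA ha.1, ha.2⟩ ⟨b, hbA (hs.trans hb), hb⟩ hV
  refine ⟨h, ?_⟩
  filter_upwards [hA, Measure.ae_ne volume s] with t htA hts ht
  exact hline t (htA ht) hts

theorem le_of_ae_le_of_continuousAt (hf : ∀ c < f s, ∀ U ∈ 𝓝 s, 0 < volume (U ∩ {t | c < f t}))
    {L : ℝ → ℝ} (hL : ContinuousAt L s) {V : Set ℝ} (hV : V ∈ 𝓝 s)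
    (hle : ∀ᵐ t, t ∈ V → f t ≤ L t) : f s ≤ L s := by
  by_contra! hlt
  obtain ⟨c, hLc, hcf⟩ := exists_between hlt
  obtain ⟨t, ⟨⟨htV, htL⟩, htf⟩, htle⟩ := ((frequently_ae_mem_iff.2
    (hf c hcf _ (Filter.inter_mem hV (hL.eventually (gt_mem_nhds hLc)))).ne').and_eventually
      hle).exists
  exact (htf.trans_le (htle htV)).not_gt htL

end Chord

/-! ### The two-point formula -/

section TwoPoint

variable {N : ℕ} {S₀ μ σ r Δt : ℝ} {f : ℝ → ℝ}

theorem twoPointValue_zero (y : Fin 0 → Fin 2 → ℝ) : twoPointValue S₀ μ σ r Δt 0 f y = f S₀ := by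
  simp [twoPointValue]

theorem twoPointValue_succ (hσ : 0 < σ) {y : Fin (N + 1) → Fin 2 → ℝ}
    (hy : y ∈ pairFamilies μ σ r Δt (N + 1)) :
    twoPointValue S₀ μ σ r Δt (N + 1) f y
      = lossMass (rho μ σ r Δt) (y 0 0, y 0 1)
          * twoPointValue (S₀ * (1 + rho μ σ r Δt (y 0 0))) μ σ r Δt N f (Fin.tail y)
        + gainMass (rho μ σ r Δt) (y 0 0, y 0 1)
          * twoPointValue (S₀ * (1 + rho μ σ r Δt (y 0 1))) μ σ r Δt N f (Fin.tail y) := by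
  have hloss : rho μ σ r Δt (y 0 0) ≤ 0 := (rho_nonpos_iff hσ).2 (hy 0).1
  have hgain : 0 < rho μ σ r Δt (y 0 1) := (rho_pos_iff hσ).2 (hy 0).2
  have hgap : 0 < rho μ σ r Δt (y 0 1) - rho μ σ r Δt (y 0 0) := by linarith
  have hlossMass : lossMass (rho μ σ r Δt) (y 0 0, y 0 1)
      = |rho μ σ r Δt (y 0 1)| / |rho μ σ r Δt (y 0 1) - rho μ σ r Δt (y 0 0)| := by
    rw [lossMass_eq hloss hgain, abs_of_pos hgain, abs_of_pos hgap]
  have hgainMass : gainMass (rho μ σ r Δt) (y 0 0, y 0 1)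
      = |rho μ σ r Δt (y 0 0)| / |rho μ σ r Δt (y 0 0) - rho μ σ r Δt (y 0 1)| := by
    rw [gainMass_eq hloss hgain, abs_of_nonpos hloss, abs_sub_comm, abs_of_pos hgap]
  simp only [twoPointValue, ← one_add_rho hσ.ne', add_sub_cancel_left, add_sub_add_left_eq_sub]
  rw [← (Fin.consEquiv fun _ => Fin 2).sum_comp, Fintype.sum_prod_type, Fin.sum_univ_two,
    hlossMass, hgainMass, Finset.mul_sum, Finset.mul_sum]
  congr 1 <;> refine Finset.sum_congr rfl fun i _ => ?_ <;>
    simp only [Fin.consEquiv_apply, Fin.prod_univ_succ, Fin.cons_zero, Fin.cons_succ, Fin.tail,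
      zero_add, show (1 : Fin 2) + 1 = 0 from rfl] <;> ring_nf

theorem twoPointValue_le_of_le_affine (hσ : 0 < σ) {A B : ℝ}
    (hf : ∀ t, 0 < t → f t ≤ A + B * t) (hS₀ : 0 < S₀) {y : Fin N → Fin 2 → ℝ}
    (hy : y ∈ pairFamilies μ σ r Δt N) : twoPointValue S₀ μ σ r Δt N f y ≤ A + B * S₀ := by
  induction N generalizing S₀ with
  | zero => exact (twoPointValue_zero y).trans_le (hf S₀ hS₀)
  | succ N ih =>
    have htail : Fin.tail y ∈ pairFamilies μ σ r Δt N := fun s => hy s.succ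
    have hpos := fun u => mul_pos hS₀ (one_add_rho_pos μ σ r Δt u)
    have hloss : rho μ σ r Δt (y 0 0) ≤ 0 := (rho_nonpos_iff hσ).2 (hy 0).1
    have hgain : 0 < rho μ σ r Δt (y 0 1) := (rho_pos_iff hσ).2 (hy 0).2
    have hmass := lossMass_add_gainMass (ρ := rho μ σ r Δt) (p := (y 0 0, y 0 1)) hgain
    have hmean := lossMass_mul_add_gainMass_mul (p := (y 0 0, y 0 1)) hloss hgain
    rw [twoPointValue_succ hσ hy]
    refine (add_le_add (mul_le_mul_of_nonneg_left (ih (hpos _) htail) lossMass_nonneg)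
      (mul_le_mul_of_nonneg_left (ih (hpos _) htail) gainMass_nonneg)).trans_eq ?_
    linear_combination (A + B * S₀) * hmass + B * S₀ * hmean

/-- The family whose pairs all put their whole mass on the point `-d` of zero return. -/
noncomputable def trivialPairs (μ σ r Δt : ℝ) (N : ℕ) : Fin N → Fin 2 → ℝ :=
  fun _ => ![-shift μ σ r Δt, -shift μ σ r Δt + 1]

theorem trivialPairs_mem_pairFamilies : trivialPairs μ σ r Δt N ∈ pairFamilies μ σ r Δt N :=
  fun _ => by simp [trivialPairs]

theorem twoPointValue_trivialPairs (hσ : 0 < σ) :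
    twoPointValue S₀ μ σ r Δt N f (trivialPairs μ σ r Δt N) = f S₀ := by
  induction N with
  | zero => exact twoPointValue_zero _
  | succ N ih =>
    have hgain := (rho_pos_iff hσ (μ := μ) (r := r) (Δt := Δt)).2 (lt_add_one (-shift μ σ r Δt))
    have hmass := lossMass_add_gainMass (ρ := rho μ σ r Δt)
      (p := (-shift μ σ r Δt, -shift μ σ r Δt + 1)) hgain
    have hgainMass : gainMass (rho μ σ r Δt) (-shift μ σ r Δt, -shift μ σ r Δt + 1) = 0 := by
      simp [gainMass, rho_neg_shift hσ.ne']
    have htail : Fin.tail (trivialPairs μ σ r Δt (N + 1)) = trivialPairs μ σ r Δt N := rfl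
    rw [twoPointValue_succ hσ trivialPairs_mem_pairFamilies, htail]
    simp only [trivialPairs, Matrix.cons_val_zero, Matrix.cons_val_one, hgainMass,
      rho_neg_shift hσ.ne', add_zero, mul_one, zero_mul] at hmass ⊢
    rw [hmass, one_mul]
    exact ih

theorem exists_twoPointValue_eq_chord (hS₀ : 0 < S₀) (hσ : 0 < σ) (f : ℝ → ℝ) {a b : ℝ}
    (ha : 0 < a) (haS : a ≤ S₀) (hSb : S₀ < b) :
    ∃ y ∈ pairFamilies μ σ r Δt (N + 1),
      twoPointValue S₀ μ σ r Δt (N + 1) f y = chord f S₀ a b := by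
  obtain ⟨u, hu⟩ := exists_one_add_rho_eq (μ := μ) (r := r) (Δt := Δt) hσ.ne' (div_pos ha hS₀)
  obtain ⟨v, hv⟩ :=
    exists_one_add_rho_eq (μ := μ) (r := r) (Δt := Δt) hσ.ne' (div_pos (hS₀.trans hSb) hS₀)
  have hloss : rho μ σ r Δt u ≤ 0 := by linarith [(div_le_one hS₀).2 haS]
  have hgain : 0 < rho μ σ r Δt v := by linarith [(one_lt_div hS₀).2 hSb]
  have hmem : (Fin.cons ![u, v] (trivialPairs μ σ r Δt N) : Fin (N + 1) → Fin 2 → ℝ)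
      ∈ pairFamilies μ σ r Δt (N + 1) :=
    Fin.cases ⟨(rho_nonpos_iff hσ).1 hloss, (rho_pos_iff hσ).1 hgain⟩ trivialPairs_mem_pairFamilies
  refine ⟨_, hmem, ?_⟩
  have hchord := chord_eq_lossMass_gainMass (f := f) (p := (u, v)) hS₀.ne' hloss hgain
  simp only [hu, hv, mul_div_cancel₀ _ hS₀.ne'] at hchord
  simp only [twoPointValue_succ hσ hmem, Fin.tail_cons, twoPointValue_trivialPairs hσ, hchord,
    Fin.cons_zero, Matrix.cons_val_zero, Matrix.cons_val_one, hu, hv, mul_div_cancel₀ _ hS₀.ne']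

end TwoPoint

/-! ### Finite products of measures -/

section Pi

variable {E : Type*} [MeasurableSpace E] {N : ℕ}

theorem cons_eq_piFinSuccAbove_symm :
    (fun z : E × (Fin N → E) => (Fin.cons z.1 z.2 : Fin (N + 1) → E))
      = (MeasurableEquiv.piFinSuccAbove (fun _ => E) 0).symm := by
  ext z : 1
  simp [MeasurableEquiv.piFinSuccAbove, Fin.insertNthEquiv]

theorem measurableEmbedding_cons :
    MeasurableEmbedding fun z : E × (Fin N → E) => (Fin.cons z.1 z.2 : Fin (N + 1) → E) := by
  rw [cons_eq_piFinSuccAbove_symm]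
  exact (MeasurableEquiv.piFinSuccAbove _ 0).symm.measurableEmbedding

theorem measurePreserving_cons (q : Fin (N + 1) → Measure E) [∀ i, SigmaFinite (q i)] :
    MeasurePreserving (fun z : E × (Fin N → E) => (Fin.cons z.1 z.2 : Fin (N + 1) → E))
      ((q 0).prod (Measure.pi fun i => q i.succ)) (Measure.pi q) := by
  rw [cons_eq_piFinSuccAbove_symm]
  simpa only [Fin.succAbove_zero] using (measurePreserving_piFinSuccAbove q 0).symm

theorem pi_absolutelyContinuous {q p : Fin N → Measure E} [∀ i, SigmaFinite (q i)]
    [∀ i, SigmaFinite (p i)] (h : ∀ i, q i ≪ p i) : Measure.pi q ≪ Measure.pi p := by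
  induction N with
  | zero => rw [Subsingleton.elim q p]
  | succ N ih =>
    rw [← (measurePreserving_cons q).map_eq, ← (measurePreserving_cons p).map_eq]
    exact ((h 0).prod (ih fun i => h i.succ)).map measurableEmbedding_cons.measurable

theorem pi_update_combination {ι : Type*} [Fintype ι] [DecidableEq ι] (q : ι → Measure E)
    [∀ i, IsFiniteMeasure (q i)] (j : ι) (A B : Measure E) [IsFiniteMeasure A] [IsFiniteMeasure B]
    (a b : ℝ≥0) :
    Measure.pi (Function.update q j (a • A + b • B))
      = a • Measure.pi (Function.update q j A) + b • Measure.pi (Function.update q j B) := by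
  have hfinite : ∀ M : Measure E, IsFiniteMeasure M →
      ∀ i, IsFiniteMeasure (Function.update q j M i) :=
    fun M hM => (Function.forall_update_iff q fun _ ν => IsFiniteMeasure ν).2
      ⟨hM, fun _ _ => inferInstance⟩
  have := hfinite A inferInstance
  have := hfinite B inferInstance
  have := hfinite (a • A + b • B) inferInstance
  refine Measure.pi_eq fun s _ => ?_
  simp only [Measure.add_apply, Measure.smul_apply, Measure.pi_pi,
    Function.apply_update fun i (ν : Measure E) => ν (s i),
    Finset.prod_update_of_mem (Finset.mem_univ j), ENNReal.smul_def, smul_eq_mul]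
  ring

end Pi

/-! ### Weak duality -/

theorem integral_pi_le_of_superhedge {E : Type*} [MeasurableSpace E] {N : ℕ} {ρ : E → ℝ}
    {q : Fin N → Measure E} [∀ i, IsProbabilityMeasure (q i)] (hρ : ∀ i, Integrable ρ (q i))
    (hρ0 : ∀ i, ∫ u, ρ u ∂q i = 0) {F : (Fin N → E) → ℝ} (hF : Integrable F (Measure.pi q)) {x : ℝ}
    {K : Fin N → (Fin N → E) → ℝ} (hK : ∀ i, DependsOn (K i) (Set.Iio i))
    (hle : ∀ᵐ y ∂Measure.pi q, F y ≤ x + ∑ i, K i y * ρ (y i)) :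
    ∫ y, F y ∂Measure.pi q ≤ x := by
  induction N generalizing x with
  | zero =>
    simp only [Finset.univ_eq_empty, Finset.sum_empty, add_zero] at hle
    simpa using integral_mono_ae hF (integrable_const x) hle
  | succ N ih =>
    have hcons := measurePreserving_cons q
    have hFcons : Integrable (fun z : E × (Fin N → E) => F (Fin.cons z.1 z.2))
      ((q 0).prod (Measure.pi fun i => q i.succ)) := hcons.integrable_comp_of_integrable hF
    obtain ⟨y₀⟩ := (Measure.pi q).nonempty_of_neZero
    have hK0 : ∀ y, K 0 y = K 0 y₀ := fun y => hK 0 fun j hj => absurd hj (Fin.not_lt_zero j)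
    have hsection : ∀ᵐ u ∂q 0, ∫ y, F (Fin.cons u y) ∂(Measure.pi fun i => q i.succ)
        ≤ x + K 0 y₀ * ρ u := by
      filter_upwards [Measure.ae_ae_of_ae_prod (hcons.quasiMeasurePreserving.ae hle),
        hFcons.prod_right_ae] with u hu hFu
      refine ih (fun i => hρ i.succ) (fun i => hρ0 i.succ) hFu
        (K := fun i y => K i.succ (Fin.cons u y)) (fun i y z hyz => hK i.succ fun j hj => ?_) ?_
      · cases j using Fin.cases with
        | zero => rfl
        | succ j => exact hyz j (Fin.succ_lt_succ_iff.1 hj)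
      · filter_upwards [hu] with y hy
        simpa only [Fin.sum_univ_succ, hK0, Fin.cons_zero, Fin.cons_succ, add_assoc] using hy
    have hbound : Integrable (fun u => x + K 0 y₀ * ρ u) (q 0) :=
      (integrable_const x).add ((hρ 0).const_mul _)
    calc ∫ y, F y ∂Measure.pi q
        = ∫ u, ∫ y, F (Fin.cons u y) ∂(Measure.pi fun i => q i.succ) ∂q 0 := by
          rw [← hcons.integral_comp measurableEmbedding_cons, integral_prod _ hFcons]
      _ ≤ ∫ u, (x + K 0 y₀ * ρ u) ∂q 0 :=
          integral_mono_ae hFcons.integral_prod_left hbound hsection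
      _ = x := by
          rw [integral_add (integrable_const x) ((hρ 0).const_mul _), integral_const_mul, hρ0]
          simp

section SuperHedge

variable {N : ℕ} {S₀ μ σ r Δt : ℝ} {f : ℝ → ℝ}

instance : IsProbabilityMeasure (stepLaw Δt) := by
  unfold stepLaw; infer_instance

theorem dependsOn_of_measurable_coordSigma {i : Fin N} {H : Path N → ℝ}
    (hH : Measurable[coordSigma N i.val] H) : DependsOn H (Set.Iio i) := by
  have hle : coordSigma N i.val ≤ Filtration.piFinset (X := fun _ => ℝ) (Finset.Iio i) := by
    rw [Filtration.piFinset_eq_comap_restrict]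
    refine iSup₂_le fun j hj => measurable_iff_comap_le.1 ?_
    have hj : j ∈ (Finset.Iio i : Set (Fin N)) := by simpa using hj
    exact (measurable_pi_apply (X := fun _ => ℝ) (⟨j, hj⟩ : (Finset.Iio i : Set (Fin N)))).comp
      (comap_measurable _)
  simpa using (hH.mono hle le_rfl).dependsOn_of_piFinset

theorem integral_pi_le_of_mem_superHedgeCapitals {x : ℝ}
    (hx : x ∈ superHedgeCapitals S₀ μ σ r Δt N f) {q : Fin N → Measure ℝ}
    [∀ i, IsProbabilityMeasure (q i)] (hq : ∀ i, q i ≪ stepLaw Δt)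
    (hρ : ∀ i, Integrable (rho μ σ r Δt) (q i)) (hρ0 : ∀ i, ∫ u, rho μ σ r Δt u ∂q i = 0)
    (hf : Integrable (fun y => f (price S₀ μ σ r Δt N y)) (Measure.pi q)) :
    ∫ y, f (price S₀ μ σ r Δt N y) ∂Measure.pi q ≤ x := by
  obtain ⟨H, hH, hle⟩ := hx
  refine integral_pi_le_of_superhedge hρ hρ0 hf
    (K := fun i y => H i y * price S₀ μ σ r Δt i.val y)
    (fun i y z hyz => congrArg₂ (· * ·)
      (dependsOn_of_measurable_coordSigma (hH i) hyz) (dependsOn_price i hyz)) ?_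
  filter_upwards [(pi_absolutelyContinuous hq).ae_le hle] with y hy
  simpa only [price_succ_sub, mul_assoc] using hy

end SuperHedge

/-! ### Mixtures of two-point laws -/

/-- The mixture, with mixing measure `m`, of the laws on `{y₁, y₂}` of mean zero return. -/
noncomputable def twoPointMixture (ρ : ℝ → ℝ) (m : Measure (ℝ × ℝ)) : Measure ℝ :=
  (m.withDensity fun p => ENNReal.ofReal (lossMass ρ p)).map Prod.fst +
    (m.withDensity fun p => ENNReal.ofReal (gainMass ρ p)).map Prod.snd

section Mixture

variable {ρ : ℝ → ℝ} {m : Measure (ℝ × ℝ)}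

theorem lintegral_twoPointMixture (hρ : Measurable ρ) (m : Measure (ℝ × ℝ)) {h : ℝ → ℝ≥0∞}
    (hh : Measurable h) :
    ∫⁻ u, h u ∂twoPointMixture ρ m = ∫⁻ p, (ENNReal.ofReal (lossMass ρ p) * h p.1
      + ENNReal.ofReal (gainMass ρ p) * h p.2) ∂m := by
  have hlossMass := (measurable_lossMass hρ).ennreal_ofReal
  have hgainMass := (measurable_gainMass hρ).ennreal_ofReal
  have hfst : Measurable fun p : ℝ × ℝ => h p.1 := hh.comp measurable_fst
  have hsnd : Measurable fun p : ℝ × ℝ => h p.2 := hh.comp measurable_snd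
  rw [twoPointMixture, lintegral_add_measure, lintegral_map hh measurable_fst,
    lintegral_map hh measurable_snd, lintegral_withDensity_eq_lintegral_mul _ hlossMass hfst,
    lintegral_withDensity_eq_lintegral_mul _ hgainMass hsnd,
    ← lintegral_add_left (hlossMass.mul hfst)]
  rfl

theorem twoPointMixture_apply (hρ : Measurable ρ) (m : Measure (ℝ × ℝ)) {A : Set ℝ}
    (hA : MeasurableSet A) : twoPointMixture ρ m A
      = ∫⁻ p, (ENNReal.ofReal (lossMass ρ p) * A.indicator 1 p.1
        + ENNReal.ofReal (gainMass ρ p) * A.indicator 1 p.2) ∂m := by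
  rw [← lintegral_twoPointMixture hρ m (measurable_one.indicator hA), lintegral_indicator_one hA]

theorem twoPointMixture_combination (hρ : Measurable ρ) (m n : Measure (ℝ × ℝ)) (a b : ℝ≥0) :
    twoPointMixture ρ (a • m + b • n) = a • twoPointMixture ρ m + b • twoPointMixture ρ n := by
  ext A hA
  simp only [Measure.add_apply, Measure.smul_apply, twoPointMixture_apply hρ _ hA,
    lintegral_add_measure, lintegral_smul_measure]

theorem twoPointMixture_absolutelyContinuous {P : Measure ℝ} [SFinite P]
    (hm : m ≪ P.prod P) : twoPointMixture ρ m ≪ P :=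
  Measure.AbsolutelyContinuous.add_left_iff.2
    ⟨(((withDensity_absolutelyContinuous _ _).trans hm).map measurable_fst).trans
      Measure.quasiMeasurePreserving_fst.absolutelyContinuous,
    (((withDensity_absolutelyContinuous _ _).trans hm).map measurable_snd).trans
      Measure.quasiMeasurePreserving_snd.absolutelyContinuous⟩

theorem ae_twoPointMixture {α β : Measure ℝ} [SFinite α] [SFinite β] {s : ℝ → Prop}
    (hα : ∀ᵐ u ∂α, s u) (hβ : ∀ᵐ v ∂β, s v) : ∀ᵐ u ∂twoPointMixture ρ (α.prod β), s u :=
  ae_add_measure_iff.2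
    ⟨(((withDensity_absolutelyContinuous _ _).map measurable_fst).trans
      Measure.quasiMeasurePreserving_fst.absolutelyContinuous).ae_le hα,
    (((withDensity_absolutelyContinuous _ _).map measurable_snd).trans
      Measure.quasiMeasurePreserving_snd.absolutelyContinuous).ae_le hβ⟩

theorem isProbabilityMeasure_twoPointMixture (hρ : Measurable ρ) [IsProbabilityMeasure m]
    (hgain : ∀ᵐ p ∂m, 0 < ρ p.2) : IsProbabilityMeasure (twoPointMixture ρ m) := by
  refine ⟨?_⟩
  have hmass : ∀ᵐ p ∂m,
      ENNReal.ofReal (lossMass ρ p) + ENNReal.ofReal (gainMass ρ p) = 1 := by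
    filter_upwards [hgain] with p hp
    rw [← ENNReal.ofReal_add lossMass_nonneg gainMass_nonneg, lossMass_add_gainMass hp,
      ENNReal.ofReal_one]
  simp only [twoPointMixture_apply hρ _ .univ, Set.indicator_univ, Pi.one_apply, mul_one,
    lintegral_congr_ae hmass, lintegral_const, measure_univ]

theorem lintegral_one_add_twoPointMixture (hρ : Measurable ρ) (hρ1 : ∀ u, 0 ≤ 1 + ρ u)
    [IsProbabilityMeasure m] (hm : ∀ᵐ p ∂m, ρ p.1 ≤ 0 ∧ 0 < ρ p.2) :
    ∫⁻ u, ENNReal.ofReal (1 + ρ u) ∂twoPointMixture ρ m = 1 := by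
  have hmean : ∀ᵐ p ∂m, ENNReal.ofReal (lossMass ρ p) * ENNReal.ofReal (1 + ρ p.1)
      + ENNReal.ofReal (gainMass ρ p) * ENNReal.ofReal (1 + ρ p.2) = 1 := by
    filter_upwards [hm] with p hp
    rw [← ENNReal.ofReal_mul lossMass_nonneg, ← ENNReal.ofReal_mul gainMass_nonneg,
      ← ENNReal.ofReal_add (mul_nonneg lossMass_nonneg (hρ1 _))
        (mul_nonneg gainMass_nonneg (hρ1 _)), ENNReal.ofReal_eq_one]
    linear_combination lossMass_add_gainMass hp.2 + lossMass_mul_add_gainMass_mul hp.1 hp.2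
  rw [lintegral_twoPointMixture hρ _ (hρ.const_add 1).ennreal_ofReal, lintegral_congr_ae hmean,
    lintegral_one, measure_univ]

theorem integrable_return_twoPointMixture (hρ : Measurable ρ) (hρ1 : ∀ u, 0 ≤ 1 + ρ u)
    [IsProbabilityMeasure m] (hm : ∀ᵐ p ∂m, ρ p.1 ≤ 0 ∧ 0 < ρ p.2) :
    Integrable ρ (twoPointMixture ρ m) := by
  have := isProbabilityMeasure_twoPointMixture hρ (hm.mono fun _ hp => hp.2)
  refine (integrable_add_const_iff (c := (1 : ℝ))).1 ?_
  refine ⟨(hρ.add_const 1).aestronglyMeasurable, ?_⟩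
  simp only [add_comm _ (1 : ℝ)]
  rw [hasFiniteIntegral_iff_ofReal (.of_forall hρ1), lintegral_one_add_twoPointMixture hρ hρ1 hm]
  exact ENNReal.one_lt_top

theorem integral_return_twoPointMixture (hρ : Measurable ρ) (hρ1 : ∀ u, 0 ≤ 1 + ρ u)
    [IsProbabilityMeasure m] (hm : ∀ᵐ p ∂m, ρ p.1 ≤ 0 ∧ 0 < ρ p.2) :
    ∫ u, ρ u ∂twoPointMixture ρ m = 0 := by
  have := isProbabilityMeasure_twoPointMixture hρ (hm.mono fun _ hp => hp.2)
  have hone : ∫ u, (1 + ρ u) ∂twoPointMixture ρ m = 1 := by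
    rw [integral_eq_lintegral_of_nonneg_ae (.of_forall hρ1)
      (hρ.const_add 1).aestronglyMeasurable, lintegral_one_add_twoPointMixture hρ hρ1 hm,
      ENNReal.toReal_one]
  rw [integral_add (integrable_const _) (integrable_return_twoPointMixture hρ hρ1 hm)] at hone
  simpa using hone

section Integral

variable {g : ℝ → ℝ}

theorem integrable_lossMass_mul (hρ : Measurable ρ) (hg : Measurable g)
    (hgm : Integrable g (twoPointMixture ρ m)) : Integrable (fun p => lossMass ρ p * g p.1) m := by
  have hfst := (integrable_map_measure hg.aestronglyMeasurable measurable_fst.aemeasurable).1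
    (integrable_add_measure.1 hgm).1
  rw [integrable_withDensity_iff_integrable_smul' (measurable_lossMass hρ).ennreal_ofReal
    (by simp)] at hfst
  simpa only [ENNReal.toReal_ofReal lossMass_nonneg, smul_eq_mul, Function.comp_apply] using hfst

theorem integrable_gainMass_mul (hρ : Measurable ρ) (hg : Measurable g)
    (hgm : Integrable g (twoPointMixture ρ m)) : Integrable (fun p => gainMass ρ p * g p.2) m := by
  have hsnd := (integrable_map_measure hg.aestronglyMeasurable measurable_snd.aemeasurable).1
    (integrable_add_measure.1 hgm).2
  rw [integrable_withDensity_iff_integrable_smul' (measurable_gainMass hρ).ennreal_ofReal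
    (by simp)] at hsnd
  simpa only [ENNReal.toReal_ofReal gainMass_nonneg, smul_eq_mul, Function.comp_apply] using hsnd

theorem integral_twoPointMixture (hρ : Measurable ρ) (hg : Measurable g)
    (hgm : Integrable g (twoPointMixture ρ m)) :
    ∫ u, g u ∂twoPointMixture ρ m = ∫ p, (lossMass ρ p * g p.1 + gainMass ρ p * g p.2) ∂m := by
  obtain ⟨hfst, hsnd⟩ := integrable_add_measure.1 hgm
  rw [twoPointMixture, integral_add_measure hfst hsnd,
    integral_add (integrable_lossMass_mul hρ hg hgm) (integrable_gainMass_mul hρ hg hgm),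
    integral_map measurable_fst.aemeasurable hg.aestronglyMeasurable,
    integral_map measurable_snd.aemeasurable hg.aestronglyMeasurable,
    integral_withDensity_eq_integral_toReal_smul (measurable_lossMass hρ).ennreal_ofReal (by simp),
    integral_withDensity_eq_integral_toReal_smul (measurable_gainMass hρ).ennreal_ofReal (by simp)]
  simp only [ENNReal.toReal_ofReal lossMass_nonneg, ENNReal.toReal_ofReal gainMass_nonneg,
    smul_eq_mul]

end Integral

end Mixture

section OneStep

variable {P : Measure ℝ} {ρ : ℝ → ℝ}

theorem pairLaw_eq_restrict [SFinite P] :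
    pairLaw P ρ = (P.prod P).restrict (lossSet ρ ×ˢ gainSet ρ) := Measure.prod_restrict _ _

theorem pairLaw_absolutelyContinuous [SFinite P] : pairLaw P ρ ≪ P.prod P := by
  rw [pairLaw_eq_restrict]; exact Measure.restrict_le_self.absolutelyContinuous

theorem ae_pairLaw [SFinite P] (hρ : Measurable ρ) :
    ∀ᵐ p ∂pairLaw P ρ, ρ p.1 ≤ 0 ∧ 0 < ρ p.2 := by
  rw [pairLaw_eq_restrict]
  exact ae_restrict_mem
    ((measurableSet_le hρ measurable_const).prod (measurableSet_lt measurable_const hρ))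

theorem pairLaw_univ [SFinite P] : pairLaw P ρ Set.univ = P (lossSet ρ) * P (gainSet ρ) := by
  rw [pairLaw, ← Set.univ_prod_univ, Measure.prod_prod, Measure.restrict_apply_univ,
    Measure.restrict_apply_univ]

instance [IsFiniteMeasure P] : IsFiniteMeasure (pairLaw P ρ) := by
  unfold pairLaw; infer_instance

theorem isMixingDensity_iff [IsFiniteMeasure P] (hρ1 : ∀ u, 0 ≤ 1 + ρ u) {α : ℝ × ℝ → ℝ≥0} :
    IsMixingDensity P ρ α ↔
      Measurable α ∧ (∀ᵐ p ∂pairLaw P ρ, 0 < α p) ∧ ∫⁻ p, α p ∂pairLaw P ρ = 1 := by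
  have hpos : Measurable α → ((∀ᵐ p ∂pairLaw P ρ, 0 < α p)
      ↔ pairLaw P ρ {p | 0 < α p} = P (gainSet ρ) * P (lossSet ρ)) := fun hα => by
    rw [ae_iff_measure_eq (measurableSet_lt measurable_const hα).nullMeasurableSet, pairLaw_univ,
      mul_comm]
  refine ⟨fun h => ⟨h.measurable, (hpos h.measurable).2 h.pos, h.total⟩,
    fun ⟨hα, hα0, hα1⟩ => ⟨hα, (hpos hα).1 hα0, ?_, hα1⟩⟩
  refine (lintegral_mono fun p => mul_le_of_le_one_right' (ENNReal.ofReal_le_one.2 ?_)).trans_lt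
    (hα1.trans_lt ENNReal.one_lt_top)
  have hloss : max (-ρ p.1) 0 ≤ 1 := max_le (by linarith [hρ1 p.1]) zero_le_one
  exact div_le_one_of_le₀ (by nlinarith [le_max_right (-ρ p.1) 0, le_max_right (ρ p.2) 0])
    (by positivity)

theorem twoPointMixture_withDensity_apply (hρ : Measurable ρ) {α : ℝ × ℝ → ℝ≥0}
    (hα : Measurable α) {A : Set ℝ} (hA : MeasurableSet A) :
    twoPointMixture ρ ((pairLaw P ρ).withDensity fun p => α p) A
      = ∫⁻ p, A.indicator 1 p.1 * α p * ENNReal.ofReal (lossMass ρ p) ∂(pairLaw P ρ)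
        + ∫⁻ p, A.indicator 1 p.2 * α p * ENNReal.ofReal (gainMass ρ p) ∂(pairLaw P ρ) := by
  have hα' := hα.coe_nnreal_ennreal
  have hind : Measurable (A.indicator (1 : ℝ → ℝ≥0∞)) := measurable_one.indicator hA
  have hfst : Measurable fun p : ℝ × ℝ => A.indicator (1 : ℝ → ℝ≥0∞) p.1 :=
    hind.comp measurable_fst
  have hsnd : Measurable fun p : ℝ × ℝ => A.indicator (1 : ℝ → ℝ≥0∞) p.2 :=
    hind.comp measurable_snd
  have hlossMass := (measurable_lossMass hρ).ennreal_ofReal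
  have hgainMass := (measurable_gainMass hρ).ennreal_ofReal
  rw [twoPointMixture_apply hρ _ hA, lintegral_withDensity_eq_lintegral_mul _ hα'
      (g := fun p => ENNReal.ofReal (lossMass ρ p) * A.indicator 1 p.1
        + ENNReal.ofReal (gainMass ρ p) * A.indicator 1 p.2)
      ((hlossMass.mul hfst).add (hgainMass.mul hsnd)),
    ← lintegral_add_left (f := fun p => A.indicator 1 p.1 * α p * ENNReal.ofReal (lossMass ρ p))
      ((hfst.mul hα').mul hlossMass)]
  refine lintegral_congr fun p => ?_
  simp only [Pi.mul_apply]
  ring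

theorem mem_oneStepMeasures_iff [IsFiniteMeasure P] (hρ : Measurable ρ) (hρ1 : ∀ u, 0 ≤ 1 + ρ u)
    {Q : Measure ℝ} :
    Q ∈ oneStepMeasures P ρ ↔ ∃ m, IsProbabilityMeasure m ∧ m ≪ pairLaw P ρ ∧ pairLaw P ρ ≪ m ∧
      Q = twoPointMixture ρ m := by
  constructor
  · rintro ⟨α, hα, hQ⟩
    obtain ⟨hmeas, hpos, htotal⟩ := (isMixingDensity_iff hρ1).1 hα
    refine ⟨(pairLaw P ρ).withDensity fun p => α p, ⟨?_⟩, withDensity_absolutelyContinuous _ _,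
      withDensity_absolutelyContinuous' hmeas.coe_nnreal_ennreal.aemeasurable ?_,
      Measure.ext fun A hA => ?_⟩
    · rw [withDensity_apply _ .univ, setLIntegral_univ, htotal]
    · filter_upwards [hpos] with p hp using by exact_mod_cast hp.ne'
    · rw [hQ A hA, twoPointMixture_withDensity_apply hρ hmeas hA]
  · rintro ⟨m, hm, hmν, hνm, rfl⟩
    set α : ℝ × ℝ → ℝ≥0 := fun p => (m.rnDeriv (pairLaw P ρ) p).toNNReal
    have hα : Measurable α := (Measure.measurable_rnDeriv _ _).ennreal_toNNReal
    have hcoe : (fun p => (α p : ℝ≥0∞)) =ᵐ[pairLaw P ρ] m.rnDeriv (pairLaw P ρ) := by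
      filter_upwards [Measure.rnDeriv_lt_top m (pairLaw P ρ)] with p hp
      exact ENNReal.coe_toNNReal hp.ne
    have hαm : (pairLaw P ρ).withDensity (fun p => α p) = m := by
      rw [withDensity_congr_ae hcoe, Measure.withDensity_rnDeriv_eq _ _ hmν]
    refine ⟨α, (isMixingDensity_iff hρ1).2 ⟨hα, ?_, ?_⟩, fun A hA => ?_⟩
    · filter_upwards [hcoe, Measure.rnDeriv_pos' hνm] with p hp hp0
      exact_mod_cast hp.symm ▸ hp0
    · rw [← setLIntegral_univ, ← withDensity_apply _ .univ, hαm, measure_univ]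
    · rw [← twoPointMixture_withDensity_apply hρ hα hA, hαm]

end OneStep

/-! ### Bounded expectations -/

section ExpectationLE

variable {Ω : Type*} [MeasurableSpace Ω] {F : Ω → ℝ} {w : ℝ} {Q Q' : Measure Ω}

/-- The measures under which the random variable `F` is integrable with expectation at most `w`. -/
def expectationLE (F : Ω → ℝ) (w : ℝ) : Set (Measure Ω) :=
  {Q | Integrable F Q ∧ ∫ ω, F ω ∂Q ≤ w}

theorem integral_combination (hQ : Integrable F Q) (hQ' : Integrable F Q') (a b : ℝ≥0) :
    ∫ ω, F ω ∂(a • Q + b • Q') = a * ∫ ω, F ω ∂Q + b * ∫ ω, F ω ∂Q' := by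
  rw [integral_add_measure hQ.smul_measure_nnreal hQ'.smul_measure_nnreal,
    integral_smul_nnreal_measure, integral_smul_nnreal_measure]
  rfl

theorem convex_expectationLE : Convex ℝ≥0 (expectationLE F w) := by
  rintro Q ⟨hQ, hQw⟩ Q' ⟨hQ', hQw'⟩ a b - - hab
  refine ⟨hQ.smul_measure_nnreal.add_measure hQ'.smul_measure_nnreal, ?_⟩
  rw [integral_combination hQ hQ']
  calc (a : ℝ) * ∫ ω, F ω ∂Q + b * ∫ ω, F ω ∂Q' ≤ a * w + b * w := by gcongr
    _ = w := by rw [← add_mul, ← NNReal.coe_add, hab, NNReal.coe_one, one_mul]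

theorem integrable_of_nnreal_smul_measure {c : ℝ≥0} (hc : c ≠ 0) (h : Integrable F (c • Q)) :
    Integrable F Q := by
  simpa only [smul_smul, inv_mul_cancel₀ hc, one_smul] using h.smul_measure_nnreal (c := c⁻¹)

theorem mem_expectationLE_of_forall_combination_mem
    (h : ∀ a b : ℝ≥0, 0 < b → a + b = 1 → a • Q + b • Q' ∈ expectationLE F w) :
    Q ∈ expectationLE F w := by
  obtain ⟨hQ, hQ'⟩ := integrable_add_measure.1
    (h (1 / 2) (1 / 2) (by norm_num) (by norm_num)).1
  replace hQ := integrable_of_nnreal_smul_measure (by norm_num) hQ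
  replace hQ' := integrable_of_nnreal_smul_measure (by norm_num) hQ'
  refine ⟨hQ, le_of_tendsto (f := fun b : ℝ => (1 - b) * ∫ ω, F ω ∂Q + b * ∫ ω, F ω ∂Q')
    (x := 𝓝[>] 0) ?_ ?_⟩
  · exact tendsto_nhdsWithin_of_tendsto_nhds (Continuous.tendsto' (by fun_prop) _ _ (by simp))
  · filter_upwards [Ioo_mem_nhdsGT one_pos] with b ⟨hb0, hb1⟩
    lift b to ℝ≥0 using hb0.le
    have hmem := (h (1 - b) b (mod_cast hb0) (tsub_add_cancel_of_le (mod_cast hb1.le))).2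
    rwa [integral_combination hQ hQ', NNReal.coe_sub (mod_cast hb1.le)] at hmem

theorem exists_cons_mem_expectationLE {E : Type*} [MeasurableSpace E] {N : ℕ}
    {q : Fin (N + 1) → Measure E} [∀ i, IsProbabilityMeasure (q i)] {F : (Fin (N + 1) → E) → ℝ}
    (hF : Measure.pi q ∈ expectationLE F w) {p : (Fin N → E) → Prop}
    (hp : ∀ᵐ y ∂Measure.pi fun i => q i.succ, p y) :
    ∃ y, p y ∧ q 0 ∈ expectationLE (fun u => F (Fin.cons u y)) w := by
  have hcons := measurePreserving_cons q
  have hint := (hcons.integrable_comp_emb measurableEmbedding_cons).2 hF.1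
  have hle : ∫ y, ∫ u, F (Fin.cons u y) ∂q 0 ∂(Measure.pi fun i => q i.succ) ≤ w :=
    (integral_prod_symm _ hint).symm.trans_le
      ((hcons.integral_comp measurableEmbedding_cons F).trans_le hF.2)
  obtain ⟨y, hy, hyle⟩ := exists_notMem_null_le_integral hint.integral_prod_right
    (ae_iff.1 (hp.and hint.prod_left_ae))
  obtain ⟨hpy, hinty⟩ := not_not.1 hy
  exact ⟨y, hpy, hinty, hyle.trans hle⟩

end ExpectationLE

/-! ### Relaxation of the mixing measure -/

/-- The one-step measures whose mixing measure is only required to be absolutely continuous with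
respect to, instead of equivalent to, the pair law. -/
def relaxedMeasures (P : Measure ℝ) (ρ : ℝ → ℝ) : Set (Measure ℝ) :=
  {Q | ∃ m, IsProbabilityMeasure m ∧ m ≪ pairLaw P ρ ∧ Q = twoPointMixture ρ m}

section Relaxed

variable {P : Measure ℝ} {ρ : ℝ → ℝ} {Q Q' : Measure ℝ}

theorem isProbabilityMeasure_of_mem_relaxedMeasures [SFinite P] (hρ : Measurable ρ)
    (hQ : Q ∈ relaxedMeasures P ρ) : IsProbabilityMeasure Q := by
  obtain ⟨m, hm, hmν, rfl⟩ := hQ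
  refine isProbabilityMeasure_twoPointMixture hρ ?_
  filter_upwards [hmν.ae_le (ae_pairLaw hρ)] with p hp using hp.2

theorem absolutelyContinuous_of_mem_relaxedMeasures [SFinite P] (hQ : Q ∈ relaxedMeasures P ρ) :
    Q ≪ P := by
  obtain ⟨m, -, hmν, rfl⟩ := hQ
  exact twoPointMixture_absolutelyContinuous (hmν.trans pairLaw_absolutelyContinuous)

theorem integrable_of_mem_relaxedMeasures [SFinite P] (hρ : Measurable ρ)
    (hρ1 : ∀ u, 0 ≤ 1 + ρ u) (hQ : Q ∈ relaxedMeasures P ρ) : Integrable ρ Q := by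
  obtain ⟨m, hm, hmν, rfl⟩ := hQ
  exact integrable_return_twoPointMixture hρ hρ1 (hmν.ae_le (ae_pairLaw hρ))

theorem integral_of_mem_relaxedMeasures [SFinite P] (hρ : Measurable ρ)
    (hρ1 : ∀ u, 0 ≤ 1 + ρ u) (hQ : Q ∈ relaxedMeasures P ρ) : ∫ u, ρ u ∂Q = 0 := by
  obtain ⟨m, hm, hmν, rfl⟩ := hQ
  exact integral_return_twoPointMixture hρ hρ1 (hmν.ae_le (ae_pairLaw hρ))

variable [IsFiniteMeasure P]

theorem oneStepMeasures_subset_relaxedMeasures (hρ : Measurable ρ) (hρ1 : ∀ u, 0 ≤ 1 + ρ u) :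
    oneStepMeasures P ρ ⊆ relaxedMeasures P ρ := fun Q hQ => by
  obtain ⟨m, hm, hmν, -, rfl⟩ := (mem_oneStepMeasures_iff hρ hρ1).1 hQ
  exact ⟨m, hm, hmν, rfl⟩

theorem oneStepMeasures_nonempty (hρ : Measurable ρ) (hρ1 : ∀ u, 0 ≤ 1 + ρ u)
    (hloss : P (lossSet ρ) ≠ 0) (hgain : P (gainSet ρ) ≠ 0) : (oneStepMeasures P ρ).Nonempty := by
  have hν : pairLaw P ρ Set.univ ≠ 0 := by rw [pairLaw_univ]; exact mul_ne_zero hloss hgain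
  exact ⟨_, (mem_oneStepMeasures_iff hρ hρ1).2 ⟨(pairLaw P ρ)[|Set.univ],
    cond_isProbabilityMeasure hν, cond_absolutelyContinuous, absolutelyContinuous_cond_univ, rfl⟩⟩

theorem combination_mem_oneStepMeasures (hρ : Measurable ρ) (hρ1 : ∀ u, 0 ≤ 1 + ρ u)
    (hQ : Q ∈ relaxedMeasures P ρ) (hQ' : Q' ∈ oneStepMeasures P ρ) {a b : ℝ≥0} (hb : 0 < b)
    (hab : a + b = 1) : a • Q + b • Q' ∈ oneStepMeasures P ρ := by
  obtain ⟨m, hm, hmν, rfl⟩ := hQ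
  obtain ⟨m', hm', hm'ν, hνm', rfl⟩ := (mem_oneStepMeasures_iff hρ hρ1).1 hQ'
  refine (mem_oneStepMeasures_iff hρ hρ1).2 ⟨a • m + b • m', ⟨?_⟩,
    Measure.AbsolutelyContinuous.add_left_iff.2
      ⟨Measure.smul_absolutelyContinuous.trans hmν, Measure.smul_absolutelyContinuous.trans hm'ν⟩,
    hνm'.trans ((Measure.absolutelyContinuous_smul (ENNReal.coe_ne_zero.2 hb.ne')).trans
      (Measure.le_add_left le_rfl).absolutelyContinuous),
    (twoPointMixture_combination hρ m m' a b).symm⟩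
  simp only [Measure.add_apply, Measure.smul_apply, measure_univ, ENNReal.smul_def, smul_eq_mul,
    mul_one]
  exact_mod_cast hab

variable {ι : Type*} [Fintype ι] {F : (ι → ℝ) → ℝ} {w : ℝ}

theorem pi_mem_expectationLE_of_relaxedMeasures (hρ : Measurable ρ) (hρ1 : ∀ u, 0 ≤ 1 + ρ u)
    (hne : (oneStepMeasures P ρ).Nonempty)
    (h : ∀ q : ι → Measure ℝ, (∀ i, q i ∈ oneStepMeasures P ρ) → Measure.pi q ∈ expectationLE F w)
    {q : ι → Measure ℝ} (hq : ∀ i, q i ∈ relaxedMeasures P ρ) :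
    Measure.pi q ∈ expectationLE F w := by
  classical
  obtain ⟨Q', hQ'⟩ := hne
  have hQ'r := oneStepMeasures_subset_relaxedMeasures hρ hρ1 hQ'
  have := isProbabilityMeasure_of_mem_relaxedMeasures hρ hQ'r
  suffices ∀ (s : Finset ι) (q : ι → Measure ℝ), (∀ i, q i ∈ relaxedMeasures P ρ) →
      (∀ i ∉ s, q i ∈ oneStepMeasures P ρ) → Measure.pi q ∈ expectationLE F w from
    this Finset.univ q hq fun i hi => absurd (Finset.mem_univ i) hi
  intro s
  induction s using Finset.induction_on with
  | empty => exact fun q _ hqs => h q fun i => hqs i (Finset.notMem_empty i)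
  | insert j s hj ih =>
    intro q hq hqs
    have := fun i => isProbabilityMeasure_of_mem_relaxedMeasures hρ (hq i)
    refine mem_expectationLE_of_forall_combination_mem
      (Q' := Measure.pi (Function.update q j Q')) fun a b hb hab => ?_
    have hmem := combination_mem_oneStepMeasures hρ hρ1 (hq j) hQ' hb hab
    have hpi := pi_update_combination q j (q j) Q' a b
    rw [Function.update_eq_self] at hpi
    rw [← hpi]
    refine ih _ ((Function.forall_update_iff q fun _ Q => Q ∈ relaxedMeasures P ρ).2
      ⟨oneStepMeasures_subset_relaxedMeasures hρ hρ1 hmem, fun i _ => hq i⟩) fun i hi => ?_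
    obtain rfl | hij := eq_or_ne i j
    · rwa [Function.update_self]
    · rw [Function.update_of_ne hij]
      exact hqs i fun his => (Finset.mem_insert.1 his).elim hij hi

end Relaxed

/-! ### Box mixtures and local integrability -/

section Box

variable {P : Measure ℝ} {ρ k : ℝ → ℝ} {A B : Set ℝ}

theorem cond_absolutelyContinuous_restrict {μ ν : Measure ℝ} (hμν : μ ≪ ν) {S : Set ℝ}
    (hAS : A ⊆ S) : μ[|A] ≪ ν.restrict S :=
  Measure.smul_absolutelyContinuous.trans
    ((Measure.restrict_mono_set μ hAS).absolutelyContinuous.trans (hμν.restrict S))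

theorem twoPointMixture_cond_mem_relaxedMeasures [SFinite P] (hP : volume ≪ P)
    (hA : A ⊆ lossSet ρ) (hA0 : volume A ≠ 0) (hA1 : volume A ≠ ∞)
    (hB : B ⊆ gainSet ρ) (hB0 : volume B ≠ 0) (hB1 : volume B ≠ ∞) :
    twoPointMixture ρ (volume[|A].prod volume[|B]) ∈ relaxedMeasures P ρ := by
  have := cond_isProbabilityMeasure_of_finite hA0 hA1
  have := cond_isProbabilityMeasure_of_finite hB0 hB1
  exact ⟨_, inferInstance, (cond_absolutelyContinuous_restrict hP hA).prod
    (cond_absolutelyContinuous_restrict hP hB), rfl⟩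

theorem integrable_of_integrable_twoPointMixture_left {α β : Measure ℝ} [SFinite α] [SFinite β]
    [NeZero β] (hρ : Measurable ρ) (hk : Measurable k) {C : ℝ} (hC : ∀ᵐ u ∂α, |ρ u| ≤ C)
    (hgain : ∀ᵐ v ∂β, 0 < ρ v) (hint : Integrable k (twoPointMixture ρ (α.prod β))) :
    Integrable k α := by
  obtain ⟨v, hv, hint⟩ := (hgain.and (integrable_lossMass_mul hρ hk hint).prod_left_ae).exists
  refine (hint.norm.const_mul ((C + ρ v) / ρ v)).mono' hk.aestronglyMeasurable ?_
  filter_upwards [hC] with u hu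
  have hloss : 0 ≤ max (-ρ u) 0 := le_max_right _ _
  have hlossC : max (-ρ u) 0 ≤ C := max_le ((neg_le_abs _).trans hu) ((abs_nonneg _).trans hu)
  have hmass : 1 ≤ (C + ρ v) / ρ v * lossMass ρ (u, v) := by
    rw [lossMass, max_eq_left hv.le, div_mul_div_cancel₀ hv.ne', one_le_div (by linarith)]
    linarith
  rw [norm_mul, Real.norm_of_nonneg lossMass_nonneg, ← mul_assoc]
  exact le_mul_of_one_le_left (norm_nonneg _) hmass

theorem integrable_of_integrable_twoPointMixture_right {α β : Measure ℝ} [SFinite α] [SFinite β]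
    [NeZero α] (hρ : Measurable ρ) (hk : Measurable k) {C : ℝ} (hC : ∀ᵐ v ∂β, |ρ v| ≤ C)
    (hloss : ∀ᵐ u ∂α, ρ u < 0) (hint : Integrable k (twoPointMixture ρ (α.prod β))) :
    Integrable k β := by
  obtain ⟨u, hu, hint⟩ := (hloss.and (integrable_gainMass_mul hρ hk hint).prod_right_ae).exists
  refine (hint.norm.const_mul ((-ρ u + C) / -ρ u)).mono' hk.aestronglyMeasurable ?_
  filter_upwards [hC] with v hv
  have hgain : 0 ≤ max (ρ v) 0 := le_max_right _ _
  have hgainC : max (ρ v) 0 ≤ C := max_le ((le_abs_self _).trans hv) ((abs_nonneg _).trans hv)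
  have hmass : 1 ≤ (-ρ u + C) / -ρ u * gainMass ρ (u, v) := by
    rw [gainMass, max_eq_left (neg_nonneg.2 hu.le), div_mul_div_cancel₀ (neg_pos.2 hu).ne',
      one_le_div (by linarith)]
    linarith
  rw [norm_mul, Real.norm_of_nonneg gainMass_nonneg, ← mul_assoc]
  exact le_mul_of_one_le_left (norm_nonneg _) hmass

theorem integrableOn_of_integrable_cond (hA : volume A ≠ ∞)
    (hk : Integrable k volume[|A]) : IntegrableOn k A := by
  by_cases hA0 : volume A = 0
  · rw [IntegrableOn, Measure.restrict_eq_zero.2 hA0]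
    exact integrable_zero_measure
  · exact (integrable_smul_measure (ENNReal.inv_ne_zero.2 hA) (ENNReal.inv_ne_top.2 hA0)).1 hk

theorem integrableOn_ball_of_relaxedMeasures [SFinite P] (hP : volume ≪ P) (hρ : Continuous ρ)
    (hρ0 : ∀ᵐ u, ρ u ≠ 0) (hk : Measurable k) {a b R : ℝ} (ha : ρ a < 0) (haR : |a| < R)
    (hb : 0 < ρ b) (hbR : |b| < R) :
    ∃ Q ∈ relaxedMeasures P ρ, ∀ τ, Integrable (fun u => k (u + τ)) Q →
      IntegrableOn (fun u => k (u + τ)) (Metric.ball 0 R) := by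
  set A := {u | ρ u < 0} ∩ Metric.ball 0 R
  set B := {u | 0 < ρ u} ∩ Metric.ball 0 R
  have hAo : IsOpen A := (isOpen_lt hρ continuous_const).inter Metric.isOpen_ball
  have hBo : IsOpen B := (isOpen_lt continuous_const hρ).inter Metric.isOpen_ball
  have hA0 : volume A ≠ 0 := hAo.measure_ne_zero _ ⟨a, ha, by simpa using haR⟩
  have hB0 : volume B ≠ 0 := hBo.measure_ne_zero _ ⟨b, hb, by simpa using hbR⟩
  have hA1 : volume A ≠ ∞ := measure_ne_top_of_subset Set.inter_subset_right measure_ball_ne_top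
  have hB1 : volume B ≠ ∞ := measure_ne_top_of_subset Set.inter_subset_right measure_ball_ne_top
  have := cond_isProbabilityMeasure_of_finite hA0 hA1
  have := cond_isProbabilityMeasure_of_finite hB0 hB1
  obtain ⟨C, hC⟩ := (isCompact_closedBall (0 : ℝ) R).exists_bound_of_continuousOn hρ.continuousOn
  have hAmem : ∀ᵐ u ∂volume[|A], u ∈ A := ae_cond_mem hAo.measurableSet
  have hBmem : ∀ᵐ u ∂volume[|B], u ∈ B := ae_cond_mem hBo.measurableSet
  refine ⟨_, twoPointMixture_cond_mem_relaxedMeasures hP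
    (Set.inter_subset_left.trans fun u (hu : ρ u < 0) => hu.le) hA0 hA1
    Set.inter_subset_left hB0 hB1, fun τ hint => ?_⟩
  have hkτ : Measurable fun u => k (u + τ) := by fun_prop
  have hintA := integrableOn_of_integrable_cond hA1 (integrable_of_integrable_twoPointMixture_left
    hρ.measurable hkτ (hAmem.mono fun u hu => hC u (Metric.ball_subset_closedBall hu.2))
    (hBmem.mono fun u hu => hu.1) hint)
  have hintB := integrableOn_of_integrable_cond hB1 (integrable_of_integrable_twoPointMixture_right
    hρ.measurable hkτ (hBmem.mono fun u hu => hC u (Metric.ball_subset_closedBall hu.2))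
    (hAmem.mono fun u hu => hu.1) hint)
  refine (hintA.union hintB).mono_set_ae ?_
  filter_upwards [hρ0] with u hu0 huR
  exact hu0.lt_or_gt.imp (⟨·, huR⟩) (⟨·, huR⟩)

end Box

/-! ### Lebesgue points -/

section LebesguePoints

variable {P : Measure ℝ} {ρ k g : ℝ → ℝ} {w : ℝ}

theorem le_integral_twoPointMixture_add {α β : Measure ℝ} [IsProbabilityMeasure α]
    [IsProbabilityMeasure β] {a b c : ℝ} (hρ : Measurable ρ) (hk : Measurable k)
    (hint : Integrable k (twoPointMixture ρ (α.prod β))) (hα : Integrable k α)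
    (hβ : Integrable k β)
    (hc : ∀ᵐ p ∂α.prod β, c ≤ lossMass ρ p * a + gainMass ρ p * b) :
    c ≤ ∫ u, k u ∂twoPointMixture ρ (α.prod β) + (∫ u, ‖k u - a‖ ∂α + ∫ v, ‖k v - b‖ ∂β) := by
  have hmass := (integrable_lossMass_mul hρ hk hint).add (integrable_gainMass_mul hρ hk hint)
  have hα' : Integrable (fun p : ℝ × ℝ => ‖k p.1 - a‖) (α.prod β) :=
    (hα.sub (integrable_const a)).norm.comp_fst β
  have hβ' : Integrable (fun p : ℝ × ℝ => ‖k p.2 - b‖) (α.prod β) :=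
    (hβ.sub (integrable_const b)).norm.comp_snd α
  have hpointwise : ∀ᵐ p ∂α.prod β, c ≤ (lossMass ρ p * k p.1 + gainMass ρ p * k p.2)
      + (‖k p.1 - a‖ + ‖k p.2 - b‖) := by
    filter_upwards [hc] with p hp
    have hloss : lossMass ρ p * (a - k p.1) ≤ ‖k p.1 - a‖ := by
      rw [norm_sub_rev]
      exact (mul_le_mul_of_nonneg_left (Real.le_norm_self _) lossMass_nonneg).trans
        (mul_le_of_le_one_left (norm_nonneg _) lossMass_le_one)
    have hgain : gainMass ρ p * (b - k p.2) ≤ ‖k p.2 - b‖ := by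
      rw [norm_sub_rev]
      exact (mul_le_mul_of_nonneg_left (Real.le_norm_self _) gainMass_nonneg).trans
        (mul_le_of_le_one_left (norm_nonneg _) gainMass_le_one)
    linarith
  calc c = ∫ _, c ∂α.prod β := by simp
    _ ≤ _ := integral_mono_ae (integrable_const c) (hmass.add (hα'.add hβ')) hpointwise
    _ = _ := by
      rw [integral_twoPointMixture hρ hk hint, integral_add' hmass (hα'.add hβ'),
        integral_add' hα' hβ', integral_fun_fst (fun u => ‖k u - a‖),
        integral_fun_snd (fun v => ‖k v - b‖)]
      simp

theorem locallyIntegrable_of_relaxedMeasures [SFinite P] (hP : volume ≪ P) (hρ : Continuous ρ)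
    (hρ0 : ∀ᵐ u, ρ u ≠ 0) {a b : ℝ} (ha : ρ a < 0) (hb : 0 < ρ b) (hg : Measurable g)
    (h : ∀ Q ∈ relaxedMeasures P ρ, ∃ᶠ τ in 𝓝 0, Integrable (fun u => g (u + τ)) Q) :
    LocallyIntegrable g := fun x => by
  have := abs_nonneg a
  have := abs_nonneg b
  have := abs_nonneg x
  obtain ⟨Q, hQ, hQg⟩ := integrableOn_ball_of_relaxedMeasures hP hρ hρ0 hg ha
    (R := |a| + |b| + |x| + 2) (by linarith) hb (by linarith)
  obtain ⟨τ, hint, hτ⟩ := ((h Q hQ).and_eventually (Metric.ball_mem_nhds 0 one_pos)).exists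
  have htranslate : IntegrableOn g (Metric.ball τ (|a| + |b| + |x| + 2)) := by
    rw [← (measurePreserving_add_right volume τ).integrableOn_comp_preimage
      (measurableEmbedding_addRight τ), Metric.preimage_add_right_ball, sub_self]
    exact hQg τ hint
  refine ⟨_, Metric.ball_mem_nhds x one_pos, htranslate.mono_set (Metric.ball_subset_ball' ?_)⟩
  have hdist := dist_triangle x 0 τ
  rw [dist_zero_right, Real.norm_eq_abs, dist_comm 0 τ] at hdist
  linarith [Metric.mem_ball.1 hτ]

theorem integral_cond_closedBall_comp_add (φ : ℝ → ℝ) (x δ τ : ℝ) :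
    ∫ u, φ (u + τ) ∂volume[|Metric.closedBall x δ] = ⨍ u in Metric.closedBall (x + τ) δ, φ u := by
  have hpre : Metric.closedBall x δ = (· + τ) ⁻¹' Metric.closedBall (x + τ) δ := by
    rw [Metric.preimage_add_right_closedBall, add_sub_cancel_right]
  rw [setAverage_eq, ← (measurePreserving_add_right volume τ).setIntegral_preimage_emb
    (measurableEmbedding_addRight τ), ← hpre, ProbabilityTheory.cond, integral_smul_measure,
    ENNReal.toReal_inv, Measure.real, Real.volume_closedBall, Real.volume_closedBall]

/-- `x` is a Lebesgue point of `g` along shrinking balls that contain `x` but need not be centred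
at it; uncentred balls are needed since the measures below are translated. -/
def IsLebesguePoint (g : ℝ → ℝ) (x : ℝ) : Prop :=
  ∀ τ δ : ℕ → ℝ, Filter.Tendsto δ Filter.atTop (𝓝[>] 0) → (∀ n, |τ n| ≤ δ n) →
    Filter.Tendsto (fun n => ⨍ u in Metric.closedBall (x + τ n) (δ n), ‖g u - g x‖)
      Filter.atTop (𝓝 0)

theorem ae_isLebesguePoint (hg : LocallyIntegrable g) : ∀ᵐ x, IsLebesguePoint g x := by
  filter_upwards [IsUnifLocDoublingMeasure.ae_tendsto_average_norm_sub volume hg 1]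
    with x hx τ δ hδ hτ
  exact hx (fun n => x + τ n) δ hδ (.of_forall fun n => by simpa using hτ n)

theorem exists_shift_le_add_average [SFinite P] (hP : volume ≪ P) (hρ : Measurable ρ)
    (hg : Measurable g) (hloc : LocallyIntegrable g)
    (h : ∀ Q ∈ relaxedMeasures P ρ, ∃ᶠ τ in 𝓝 0, Q ∈ expectationLE (fun u => g (u + τ)) w)
    {x y δ a b c : ℝ} (hδ : 0 < δ)
    (hloss : ∀ u ∈ Metric.closedBall x δ, ρ u ≤ 0) (hgain : ∀ v ∈ Metric.closedBall y δ, 0 < ρ v)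
    (hc : ∀ u ∈ Metric.closedBall x δ, ∀ v ∈ Metric.closedBall y δ,
      c ≤ lossMass ρ (u, v) * a + gainMass ρ (u, v) * b) :
    ∃ τ, |τ| ≤ δ ∧ c ≤ w + ((⨍ u in Metric.closedBall (x + τ) δ, ‖g u - a‖)
      + ⨍ v in Metric.closedBall (y + τ) δ, ‖g v - b‖) := by
  have hball : ∀ z : ℝ, volume (Metric.closedBall z δ) ≠ 0 := fun z =>
    (Metric.measure_closedBall_pos volume z hδ).ne'
  have hball' : ∀ z : ℝ, volume (Metric.closedBall z δ) ≠ ∞ := fun _ =>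
    measure_closedBall_lt_top.ne
  have := cond_isProbabilityMeasure_of_finite (hball x) (hball' x)
  have := cond_isProbabilityMeasure_of_finite (hball y) (hball' y)
  obtain ⟨τ, ⟨hint, hle⟩, hτ⟩ := ((h _ (twoPointMixture_cond_mem_relaxedMeasures hP hloss (hball x)
    (hball' x) hgain (hball y) (hball' y))).and_eventually
      (Metric.closedBall_mem_nhds 0 hδ)).exists
  have hcond (z : ℝ) : Integrable (fun u => g (u + τ)) volume[|Metric.closedBall z δ] := by
    have hint := (measurePreserving_add_right volume τ).integrableOn_comp_preimage
      (measurableEmbedding_addRight τ) |>.2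
      (hloc.integrableOn_isCompact (isCompact_closedBall (z + τ) δ))
    rw [Metric.preimage_add_right_closedBall, add_sub_cancel_right] at hint
    exact hint.smul_measure (ENNReal.inv_ne_top.2 (hball z))
  have hcm : ∀ᵐ p ∂volume[|Metric.closedBall x δ].prod volume[|Metric.closedBall y δ],
      c ≤ lossMass ρ p * a + gainMass ρ p * b := by
    filter_upwards [Measure.quasiMeasurePreserving_fst.ae (ae_cond_mem measurableSet_closedBall),
      Measure.quasiMeasurePreserving_snd.ae (ae_cond_mem measurableSet_closedBall)] with p hp hp'
    exact hc p.1 hp p.2 hp'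
  have hlower := le_integral_twoPointMixture_add hρ (by fun_prop) hint (hcond x) (hcond y) hcm
  rw [integral_cond_closedBall_comp_add (fun u => ‖g u - a‖),
    integral_cond_closedBall_comp_add (fun v => ‖g v - b‖)] at hlower
  exact ⟨τ, by simpa using hτ, hlower.trans (by gcongr)⟩

theorem lossMass_mul_add_gainMass_mul_le_of_isLebesguePoint [SFinite P] (hP : volume ≪ P)
    (hρ : Continuous ρ) (hg : Measurable g) (hloc : LocallyIntegrable g)
    (h : ∀ Q ∈ relaxedMeasures P ρ, ∃ᶠ τ in 𝓝 0, Q ∈ expectationLE (fun u => g (u + τ)) w)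
    {x y : ℝ} (hx : IsLebesguePoint g x) (hy : IsLebesguePoint g y) (hloss : ρ x < 0)
    (hgain : 0 < ρ y) : lossMass ρ (x, y) * g x + gainMass ρ (x, y) * g y ≤ w := by
  refine le_of_forall_lt_imp_le_of_dense fun c hc => ?_
  have hcont : ContinuousAt (fun p => lossMass ρ p * g x + gainMass ρ p * g y) (x, y) :=
    ((continuousAt_lossMass hρ hgain).mul_const _).add
      ((continuousAt_gainMass hρ hgain).mul_const _)
  obtain ⟨δ₀, hδ₀, hnear⟩ := Metric.nhds_basis_closedBall.eventually_iff.1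
    ((hcont.eventually (lt_mem_nhds hc)).and
      ((continuousAt_fst.eventually (hρ.continuousAt.eventually (gt_mem_nhds hloss))).and
        (continuousAt_snd.eventually (hρ.continuousAt.eventually (lt_mem_nhds hgain)))))
  rw [← closedBall_prod_same] at hnear
  have hδ : Filter.Tendsto (fun n : ℕ => δ₀ * (1 / ((n : ℝ) + 1))) Filter.atTop (𝓝[>] 0) := by
    refine tendsto_nhdsWithin_iff.2 ⟨?_, .of_forall fun n => Set.mem_Ioi.2 (by positivity)⟩
    simpa using (tendsto_one_div_add_atTop_nhds_zero_nat (𝕜 := ℝ)).const_mul δ₀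
  have hsub : ∀ (n : ℕ) (z : ℝ),
      Metric.closedBall z (δ₀ * (1 / ((n : ℝ) + 1))) ⊆ Metric.closedBall z δ₀ := fun n z =>
    Metric.closedBall_subset_closedBall (mul_le_of_le_one_right hδ₀.le
      (by rw [div_le_one] <;> linarith [n.cast_nonneg (α := ℝ)]))
  have hshift := fun n : ℕ => exists_shift_le_add_average hP hρ.measurable hg hloc h
    (x := x) (y := y) (δ := δ₀ * (1 / ((n : ℝ) + 1))) (a := g x) (b := g y) (c := c)
    (by positivity)
    (fun u hu => (@hnear (u, y) ⟨hsub n x hu, Metric.mem_closedBall_self hδ₀.le⟩).2.1.le)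
    (fun v hv => (@hnear (x, v) ⟨Metric.mem_closedBall_self hδ₀.le, hsub n y hv⟩).2.2)
    (fun u hu v hv => (hnear ⟨hsub n x hu, hsub n y hv⟩).1.le)
  choose τ hτ hle using hshift
  simpa using ge_of_tendsto' (((hx τ _ hδ hτ).add (hy τ _ hδ hτ)).const_add w) hle

end LebesguePoints

/-! ### Localization at the first period -/

section Localization

variable {N : ℕ} {S₀ μ σ r Δt w : ℝ} {f : ℝ → ℝ}

theorem volume_absolutelyContinuous_stepLaw (hΔt : 0 < Δt) : volume ≪ stepLaw Δt :=
  gaussianReal_absolutelyContinuous' 0 (Real.toNNReal_pos.2 hΔt).ne'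

theorem stepLaw_lossSet_ne_zero (hΔt : 0 < Δt) (hσ : 0 < σ) :
    stepLaw Δt (lossSet (rho μ σ r Δt)) ≠ 0 := fun h0 => by
  have hIic : lossSet (rho μ σ r Δt) = Set.Iic (-shift μ σ r Δt) :=
    Set.ext fun _ => rho_nonpos_iff hσ
  simpa [hIic] using volume_absolutelyContinuous_stepLaw hΔt h0

theorem stepLaw_gainSet_ne_zero (hΔt : 0 < Δt) (hσ : 0 < σ) :
    stepLaw Δt (gainSet (rho μ σ r Δt)) ≠ 0 := fun h0 => by
  have hIoi : gainSet (rho μ σ r Δt) = Set.Ioi (-shift μ σ r Δt) :=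
    Set.ext fun _ => rho_pos_iff hσ
  simpa [hIoi] using volume_absolutelyContinuous_stepLaw hΔt h0

theorem oneStepMeasures_nonempty_stepLaw (hΔt : 0 < Δt) (hσ : 0 < σ) :
    (oneStepMeasures (stepLaw Δt) (rho μ σ r Δt)).Nonempty :=
  oneStepMeasures_nonempty continuous_rho.measurable (fun u => (one_add_rho_pos μ σ r Δt u).le)
    (stepLaw_lossSet_ne_zero hΔt hσ) (stepLaw_gainSet_ne_zero hΔt hσ)

theorem ae_rho_ne_zero (hσ : σ ≠ 0) : ∀ᵐ u, rho μ σ r Δt u ≠ 0 := by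
  filter_upwards [Measure.ae_ne volume (-shift μ σ r Δt)] with u hu h0
  have hexp := one_add_rho (μ := μ) (r := r) (Δt := Δt) hσ u
  rw [h0, add_zero, eq_comm, Real.exp_eq_one_iff, mul_eq_zero_iff_left hσ] at hexp
  exact hu (by linarith)

theorem price_cons (hσ : σ ≠ 0) (u : ℝ) (y : Path N) :
    price S₀ μ σ r Δt (N + 1) (Fin.cons u y : Path (N + 1))
      = S₀ * (1 + rho μ σ r Δt (u + ∑ i, (shift μ σ r Δt + y i))) := by
  rw [price_eq_prod, Fin.prod_univ_succ]
  simp only [Fin.cons_zero, Fin.cons_succ, one_add_rho hσ, ← Real.exp_sum, ← Real.exp_add,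
    ← Finset.mul_sum, ← mul_add, add_assoc]

theorem exists_relaxedMeasures_ae_near (hΔt : 0 < Δt) (hσ : 0 < σ) {κ : ℝ} (hκ : 0 < κ) :
    ∃ Q ∈ relaxedMeasures (stepLaw Δt) (rho μ σ r Δt), ∀ᵐ u ∂Q, |shift μ σ r Δt + u| < κ := by
  set d := shift μ σ r Δt
  refine ⟨_, twoPointMixture_cond_mem_relaxedMeasures (A := Set.Ioo (-d - κ) (-d))
    (B := Set.Ioo (-d) (-d + κ)) (volume_absolutelyContinuous_stepLaw hΔt)
    (fun u hu => (rho_nonpos_iff hσ).2 hu.2.le) (by simpa using hκ) (by simp)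
    (fun u hu => (rho_pos_iff hσ).2 hu.1) (by simpa using hκ) (by simp),
    ae_twoPointMixture ?_ ?_⟩
  · filter_upwards [ae_cond_mem measurableSet_Ioo] with u hu
    exact abs_lt.2 ⟨by linarith [hu.1], by linarith [hu.2]⟩
  · filter_upwards [ae_cond_mem measurableSet_Ioo] with u hu
    exact abs_lt.2 ⟨by linarith [hu.1], by linarith [hu.2]⟩

theorem frequently_mem_expectationLE (hΔt : 0 < Δt) (hσ : 0 < σ)
    (h : ∀ q : Fin (N + 1) → Measure ℝ,
      (∀ i, q i ∈ relaxedMeasures (stepLaw Δt) (rho μ σ r Δt)) →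
        Measure.pi q ∈ expectationLE (fun y => f (price S₀ μ σ r Δt (N + 1) y)) w)
    {Q : Measure ℝ} (hQ : Q ∈ relaxedMeasures (stepLaw Δt) (rho μ σ r Δt)) :
    ∃ᶠ τ in 𝓝 0, Q ∈ expectationLE (fun u => f (S₀ * (1 + rho μ σ r Δt (u + τ)))) w := by
  refine Metric.nhds_basis_ball.frequently_iff.2 fun ε hε => ?_
  obtain ⟨Z, hZ, hnear⟩ := exists_relaxedMeasures_ae_near (μ := μ) (r := r) hΔt hσ
    (κ := ε / (N + 1)) (by positivity)
  have hq : ∀ i, (Fin.cons Q fun _ => Z : Fin (N + 1) → Measure ℝ) i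
      ∈ relaxedMeasures (stepLaw Δt) (rho μ σ r Δt) := Fin.cases hQ fun _ => hZ
  have := fun i => isProbabilityMeasure_of_mem_relaxedMeasures continuous_rho.measurable (hq i)
  have := isProbabilityMeasure_of_mem_relaxedMeasures continuous_rho.measurable hZ
  have htail : ∀ᵐ y ∂Measure.pi fun _ : Fin N => Z, ∀ i, |shift μ σ r Δt + y i| < ε / (N + 1) :=
    ae_all_iff.2 fun i => (Measure.quasiMeasurePreserving_eval (fun _ => Z) i).ae hnear
  obtain ⟨y, hy, hmem⟩ := exists_cons_mem_expectationLE (h _ hq) htail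
  refine ⟨∑ i, (shift μ σ r Δt + y i), ?_, by
    simpa only [price_cons hσ.ne', Fin.cons_zero] using hmem⟩
  rw [mem_ball_zero_iff]
  calc ‖∑ i, (shift μ σ r Δt + y i)‖ ≤ ∑ _i : Fin N, ε / (N + 1) :=
        norm_sum_le_of_le _ fun i _ => (hy i).le
    _ = N / (N + 1) * ε := by simp; ring
    _ < ε := mul_lt_of_lt_one_left hε (by rw [div_lt_one] <;> linarith [N.cast_nonneg (α := ℝ)])

end Localization

/-! ### The supporting line of the payoff -/

section Payoff

variable {N : ℕ} {S₀ μ σ r Δt w : ℝ} {f : ℝ → ℝ}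

theorem ae_exists_price_eq (hS₀ : 0 < S₀) (hσ : σ ≠ 0) {p : ℝ → Prop} (hp : ∀ᵐ u, p u) :
    ∀ᵐ t, 0 < t → ∃ u, p u ∧ S₀ * (1 + rho μ σ r Δt u) = t := by
  have hdiff : Differentiable ℝ fun u => S₀ * (1 + rho μ σ r Δt u) := by
    unfold rho; fun_prop
  refine measure_mono_null (fun t ht => ?_)
    (addHaar_image_eq_zero_of_differentiableOn_of_addHaar_eq_zero volume hdiff.differentiableOn
      (ae_iff.1 hp))
  obtain ⟨htpos, hnot⟩ := Classical.not_imp.1 ht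
  obtain ⟨u, hu⟩ := exists_one_add_rho_eq (μ := μ) (r := r) (Δt := Δt) hσ (div_pos htpos hS₀)
  have hut : S₀ * (1 + rho μ σ r Δt u) = t := by rw [hu, mul_div_cancel₀ _ hS₀.ne']
  exact ⟨u, fun hpu => hnot ⟨u, hpu, hut⟩, hut⟩

theorem exists_ae_supporting_line_of_expectationLE (hS₀ : 0 < S₀) (hΔt : 0 < Δt) (hσ : 0 < σ)
    (hf : Measurable f)
    (h : ∀ q : Fin (N + 1) → Measure ℝ,
      (∀ i, q i ∈ relaxedMeasures (stepLaw Δt) (rho μ σ r Δt)) →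
        Measure.pi q ∈ expectationLE (fun y => f (price S₀ μ σ r Δt (N + 1) y)) w) :
    ∃ H, ∀ᵐ t, 0 < t → f t ≤ w + H * (t - S₀) := by
  have hP := volume_absolutelyContinuous_stepLaw hΔt
  have hρ : Continuous (rho μ σ r Δt) := continuous_rho
  have hg : Measurable fun u => f (S₀ * (1 + rho μ σ r Δt u)) :=
    hf.comp (by have := hρ.measurable; fun_prop)
  have hfreq := fun Q hQ => frequently_mem_expectationLE hΔt hσ h (Q := Q) hQ
  obtain ⟨a, ha⟩ := exists_one_add_rho_eq (μ := μ) (r := r) (Δt := Δt) hσ.ne' one_half_pos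
  obtain ⟨b, hb⟩ := exists_one_add_rho_eq (μ := μ) (r := r) (Δt := Δt) hσ.ne' two_pos
  have hloc := locallyIntegrable_of_relaxedMeasures hP hρ (ae_rho_ne_zero hσ.ne')
    (a := a) (b := b) (by linarith) (by linarith) hg fun Q hQ => (hfreq Q hQ).mono fun _ => And.left
  have hprices := ae_exists_price_eq (μ := μ) (r := r) (Δt := Δt) hS₀ hσ.ne'
    (ae_isLebesguePoint hloc)
  refine exists_ae_supporting_line hS₀ hprices ?_
  rintro _ ⟨u, hu, rfl⟩ _ ⟨v, hv, rfl⟩ hlt hgt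
  have hloss : rho μ σ r Δt u < 0 := by linarith [(mul_lt_iff_lt_one_right hS₀).1 hlt]
  have hgain : 0 < rho μ σ r Δt v := by linarith [(lt_mul_iff_one_lt_right hS₀).1 hgt]
  rw [chord_eq_lossMass_gainMass (p := (u, v)) hS₀.ne' hloss.le hgain]
  exact lossMass_mul_add_gainMass_mul_le_of_isLebesguePoint hP hρ hg hloc hfreq hu hv hloss hgain

theorem twoPointValue_le_of_expectationLE (hS₀ : 0 < S₀) (hΔt : 0 < Δt) (hσ : 0 < σ)
    (hf : Measurable f)
    (hreg : ∀ s : ℝ, 0 < s → ∀ c : ℝ, c < f s → ∀ U ∈ 𝓝 s, 0 < volume (U ∩ {t | c < f t}))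
    (h : ∀ q : Fin N → Measure ℝ,
      (∀ i, q i ∈ oneStepMeasures (stepLaw Δt) (rho μ σ r Δt)) →
        Measure.pi q ∈ expectationLE (fun y => f (price S₀ μ σ r Δt N y)) w)
    {y : Fin N → Fin 2 → ℝ} (hy : y ∈ pairFamilies μ σ r Δt N) :
    twoPointValue S₀ μ σ r Δt N f y ≤ w := by
  cases N with
  | zero =>
    rw [twoPointValue_zero]
    simpa [price_zero, Measure.real, Measure.pi_empty_univ] using (h finZeroElim finZeroElim).2
  | succ N =>
    obtain ⟨H, hline⟩ := exists_ae_supporting_line_of_expectationLE hS₀ hΔt hσ hf fun q hq =>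
      pi_mem_expectationLE_of_relaxedMeasures continuous_rho.measurable
        (fun u => (one_add_rho_pos μ σ r Δt u).le) (oneStepMeasures_nonempty_stepLaw hΔt hσ) h hq
    have haffine : ∀ t, 0 < t → f t ≤ w - H * S₀ + H * t := fun t ht =>
      le_of_ae_le_of_continuousAt (hreg t ht) (L := fun t => w - H * S₀ + H * t)
        (by fun_prop) (Ioi_mem_nhds ht) (hline.mono fun u hu hu0 => (hu hu0).trans_eq (by ring))
    simpa using twoPointValue_le_of_le_affine hσ haffine hS₀ hy

end Payoff

/-! ### The fair price -/

section FairPrice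

variable {N : ℕ} {S₀ μ σ r Δt : ℝ} {f : ℝ → ℝ}

theorem pi_mem_martingaleMeasures {q : Fin N → Measure ℝ}
    (hq : ∀ i, q i ∈ oneStepMeasures (stepLaw Δt) (rho μ σ r Δt)) :
    Measure.pi q ∈ martingaleMeasures μ σ r Δt N :=
  subset_convexHull _ _ ⟨q, hq, rfl⟩

theorem integral_le_of_mem_martingaleMeasures {x : ℝ}
    (hint : ∀ Q ∈ martingaleMeasures μ σ r Δt N, Integrable (fun y => f (price S₀ μ σ r Δt N y)) Q)
    (hx : x ∈ superHedgeCapitals S₀ μ σ r Δt N f) {Q : Measure (Path N)}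
    (hQ : Q ∈ martingaleMeasures μ σ r Δt N) : ∫ y, f (price S₀ μ σ r Δt N y) ∂Q ≤ x := by
  suffices productMeasures μ σ r Δt N ⊆ expectationLE (fun y => f (price S₀ μ σ r Δt N y)) x from
    (convexHull_min this convex_expectationLE hQ).2
  rintro _ ⟨q, hq, rfl⟩
  have hρ : Measurable (rho μ σ r Δt) := continuous_rho.measurable
  have hρ1 := fun u => (one_add_rho_pos μ σ r Δt u).le
  have hrelaxed := fun i => oneStepMeasures_subset_relaxedMeasures hρ hρ1 (hq i)
  have := fun i => isProbabilityMeasure_of_mem_relaxedMeasures hρ (hrelaxed i)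
  have hpi := hint _ (pi_mem_martingaleMeasures hq)
  exact ⟨hpi, integral_pi_le_of_mem_superHedgeCapitals hx
    (fun i => absolutelyContinuous_of_mem_relaxedMeasures (hrelaxed i))
    (fun i => integrable_of_mem_relaxedMeasures hρ hρ1 (hrelaxed i))
    (fun i => integral_of_mem_relaxedMeasures hρ hρ1 (hrelaxed i)) hpi⟩

theorem iSup_integral_le_superHedgePrice
    (hint : ∀ Q ∈ martingaleMeasures μ σ r Δt N,
      Integrable (fun y => f (price S₀ μ σ r Δt N y)) Q) :
    (⨆ Q ∈ martingaleMeasures μ σ r Δt N, ((∫ y, f (price S₀ μ σ r Δt N y) ∂Q : ℝ) : EReal))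
      ≤ superHedgePrice S₀ μ σ r Δt N f :=
  iSup₂_le fun _ hQ => le_iInf₂ fun _ hx =>
    EReal.coe_le_coe_iff.2 (integral_le_of_mem_martingaleMeasures hint hx hQ)

theorem mem_superHedgeCapitals_of_le_affine (hS₀ : 0 < S₀) {x h : ℝ}
    (hf : ∀ t, 0 < t → f t ≤ x + h * (t - S₀)) : x ∈ superHedgeCapitals S₀ μ σ r Δt N f := by
  refine ⟨fun _ _ => h, fun _ => measurable_const, .of_forall fun y => ?_⟩
  rw [← Finset.mul_sum, sum_price_sub]
  exact hf _ (price_pos hS₀ y)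

theorem mem_superHedgeCapitals_of_twoPointValue_le (hS₀ : 0 < S₀) (hσ : 0 < σ) {x : ℝ}
    (hx : ∀ y ∈ pairFamilies μ σ r Δt N, twoPointValue S₀ μ σ r Δt N f y ≤ x) :
    x ∈ superHedgeCapitals S₀ μ σ r Δt N f := by
  have hfS : f S₀ ≤ x := (twoPointValue_trivialPairs hσ).symm.trans_le
    (hx _ trivialPairs_mem_pairFamilies)
  cases N with
  | zero =>
    exact ⟨0, fun _ => measurable_const, .of_forall fun y => by simpa [price_zero] using hfS⟩
  | succ N =>
    obtain ⟨h, hline⟩ := exists_supporting_line (f := f) (A := Set.Ioi 0) (V := x) (s := S₀)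
      ⟨S₀ / 2, half_pos hS₀, half_lt_self hS₀⟩
      ⟨S₀ + 1, add_pos hS₀ one_pos, lt_add_one S₀⟩ fun a ha b _ haS hSb => by
        obtain ⟨y, hy, hyab⟩ := exists_twoPointValue_eq_chord hS₀ hσ f ha haS.le hSb
        exact hyab.symm.trans_le (hx y hy)
    refine mem_superHedgeCapitals_of_le_affine (h := h) hS₀ fun t ht => ?_
    obtain rfl | hts := eq_or_ne t S₀
    · simpa using hfS
    · exact hline t ht hts

theorem superHedgePrice_le_iSup_twoPointValue (hS₀ : 0 < S₀) (hσ : 0 < σ) :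
    superHedgePrice S₀ μ σ r Δt N f
      ≤ ⨆ y ∈ pairFamilies μ σ r Δt N, ((twoPointValue S₀ μ σ r Δt N f y : ℝ) : EReal) :=
  EReal.le_of_forall_lt_iff_le.1 fun x hx => iInf₂_le x <|
    mem_superHedgeCapitals_of_twoPointValue_le hS₀ hσ fun y hy =>
      EReal.coe_le_coe_iff.1 (iSup₂_le_iff.1 hx.le y hy)

theorem iSup_twoPointValue_le_iSup_integral (hS₀ : 0 < S₀) (hΔt : 0 < Δt) (hσ : 0 < σ)
    (hf : Measurable f)
    (hreg : ∀ s : ℝ, 0 < s → ∀ c : ℝ, c < f s → ∀ U ∈ 𝓝 s, 0 < volume (U ∩ {t | c < f t}))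
    (hint : ∀ Q ∈ martingaleMeasures μ σ r Δt N,
      Integrable (fun y => f (price S₀ μ σ r Δt N y)) Q) :
    (⨆ y ∈ pairFamilies μ σ r Δt N, ((twoPointValue S₀ μ σ r Δt N f y : ℝ) : EReal))
      ≤ ⨆ Q ∈ martingaleMeasures μ σ r Δt N,
          ((∫ y, f (price S₀ μ σ r Δt N y) ∂Q : ℝ) : EReal) :=
  EReal.le_of_forall_lt_iff_le.1 fun _ hw => iSup₂_le fun _ hy => EReal.coe_le_coe_iff.2 <|
    twoPointValue_le_of_expectationLE hS₀ hΔt hσ hf hreg (fun _ hq =>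
      have hQ := pi_mem_martingaleMeasures hq
      ⟨hint _ hQ, EReal.coe_le_coe_iff.1 (iSup₂_le_iff.1 hw.le _ hQ)⟩) hy

end FairPrice

end DriftedGBM

theorem mainTheorem6_general
    (N : ℕ) (S₀ μ σ r Δt : ℝ) (hS₀ : 0 < S₀) (hΔt : 0 < Δt) (hσ : 0 < σ)
    (f : ℝ → ℝ) (hf : Measurable f)
    (hreg : ∀ s : ℝ, 0 < s → ∀ c : ℝ, c < f s → ∀ U ∈ 𝓝 s, 0 < volume (U ∩ {t | c < f t}))
    (hint : ∀ Q ∈ DriftedGBM.martingaleMeasures μ σ r Δt N,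
      Integrable (fun y => f (DriftedGBM.price S₀ μ σ r Δt N y)) Q) :
    DriftedGBM.superHedgePrice S₀ μ σ r Δt N f
        = ⨆ Q ∈ DriftedGBM.martingaleMeasures μ σ r Δt N,
            ((∫ y, f (DriftedGBM.price S₀ μ σ r Δt N y) ∂Q : ℝ) : EReal) ∧
    (⨆ Q ∈ DriftedGBM.martingaleMeasures μ σ r Δt N,
        ((∫ y, f (DriftedGBM.price S₀ μ σ r Δt N y) ∂Q : ℝ) : EReal))
        = ⨆ y ∈ DriftedGBM.pairFamilies μ σ r Δt N,
            ((DriftedGBM.twoPointValue S₀ μ σ r Δt N f y : ℝ) : EReal) := by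
  have hduality := DriftedGBM.iSup_integral_le_superHedgePrice hint
  have hhedge : DriftedGBM.superHedgePrice S₀ μ σ r Δt N f ≤ _ :=
    DriftedGBM.superHedgePrice_le_iSup_twoPointValue hS₀ hσ
  have hconcentrate := DriftedGBM.iSup_twoPointValue_le_iSup_integral hS₀ hΔt hσ hf hreg hint
  exact ⟨(hhedge.trans hconcentrate).antisymm hduality,
    (hduality.trans hhedge).antisymm hconcentrate⟩

theorem mainTheorem6
    (N : ℕ) (S₀ μ σ r Δt : ℝ) (hS₀ : 0 < S₀) (hΔt : 0 < Δt) (hσ : 0 < σ)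
    (hσΔt : σ < 1 / (2 * Δt))
    (f : ℝ → ℝ) (hf : Measurable f)
    (hreg : ∀ s : ℝ, 0 < s → ∀ c : ℝ, c < f s → ∀ U ∈ 𝓝 s, 0 < volume (U ∩ {t | c < f t}))
    (hint : ∀ Q ∈ DriftedGBM.martingaleMeasures μ σ r Δt N,
      Integrable (fun y => f (DriftedGBM.price S₀ μ σ r Δt N y)) Q)
    (hsup : (⨆ Q ∈ DriftedGBM.martingaleMeasures μ σ r Δt N,
      ((∫ y, f (DriftedGBM.price S₀ μ σ r Δt N y) ∂Q : ℝ) : EReal)) < ⊤) :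
    DriftedGBM.superHedgePrice S₀ μ σ r Δt N f
        = ⨆ Q ∈ DriftedGBM.martingaleMeasures μ σ r Δt N,
            ((∫ y, f (DriftedGBM.price S₀ μ σ r Δt N y) ∂Q : ℝ) : EReal) ∧
    (⨆ Q ∈ DriftedGBM.martingaleMeasures μ σ r Δt N,
        ((∫ y, f (DriftedGBM.price S₀ μ σ r Δt N y) ∂Q : ℝ) : EReal))
        = ⨆ y ∈ DriftedGBM.pairFamilies μ σ r Δt N,
            ((DriftedGBM.twoPointValue S₀ μ σ r Δt N f y : ℝ) : EReal) :=
  mainTheorem6_general N S₀ μ σ r Δt hS₀ hΔt hσ f hf hreg hint
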